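/- **Setup.** Let $X$ be a compact Hausdorff space, $n\ge 1$ an integer, and suppose given: a dense linear subspace $\mathcal D\subset C^0(X)$ containing the constants; a partially ordered real vector space $\mathcal Z$ whose positive cone $\mathcal Z_+=\{\theta\ge 0\}$ spans $\mathcal Z$ and is closed in the finest vector space topology (a set is closed iff its trace on each finite dimensional subspace is closed); a linear map $dd^c\colon\mathcal D\to\mathcal Z$ vanishing on constants; and a nonzero symmetric $n$-linear map $(\theta_1,\dots,\theta_n)\mapsto\theta_1\wedge\dots\wedge\theta_n$ from $\mathcal Z^n$ to signed Radon measures on $X$, with values in positive measures on $\mathcal Z_+^n$, such that each bilinear form $(\varphi,\psi)\mapsto\int\varphi\,dd^c\psi\wedge\theta_1\wedge\dots\wedge\theta_{n-1}$ on $\mathcal D$ is symmetric, and seminegative if all $\theta_i\ge 0$. Let $\omega\in\mathcal Z_+$ be such that its class $[\omega]$ lies in the interior, for the finest vector space topology, of the image of $\mathcal Z_+$ in $\mathcal Z/dd^c\mathcal D$. Put $\mathcal D_\omega=\{\varphi\in\mathcal D\mid \omega_\varphi:=\omega+dd^c\varphi\ge 0\}$, $V_\omega=\int\omega^n$, $\mathrm{MA}_\omega(\varphi)=V_\omega^{-1}\omega_\varphi^n$,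 $\mu_\omega=\mathrm{MA}_\omega(0)$, and $$E_\omega(\varphi)=\frac1{n+1}\sum_{j=0}^nV_\omega^{-1}\int\varphi\,\omega_\varphi^j\wedge\omega^{n-j},\qquad J_\omega(\varphi,\psi)=E_\omega(\varphi)-E_\omega(\psi)+\int(\psi-\varphi)\,\mathrm{MA}_\omega(\varphi),$$ and $J_\omega(\varphi)=J_\omega(0,\varphi)$. For a Radon probability measure $\mu$ and $\psi\in\mathcal D_\omega$ put $$J_\omega(\mu,\psi)=\sup_{\varphi\in\mathcal D_\omega}\Big\{E_\omega(\varphi)-E_\omega(\psi)+\int(\psi-\varphi)\,\mu\Big\}\in[0,+\infty],\qquad J_\omega(\mu)=J_\omega(\mu,0).$$ Let $\mathcal M^1_\omega$ be the set of Radon probability measures $\mu$ with $J_\omega(\mu)<\infty$, with the *strong topology*, the coarsest refinement of the weak topology in which $J_\omega$ is continuous. Assume that $\omega$ has the *orthogonality property*: (a) for all $\varphi,\psi\in\mathcal D_\omega$ and $f\in\mathcal D$ with $\max\{\varphi,\psi\}<f$ pointwise, there is $\tau\in\mathcal D_\omega$ with $\max\{\varphi,\psi\}\le\tau<f$; (b)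 for all $f\in\mathcal D$ and $\varepsilon>0$ there is $\varphi_0\in\mathcal D_\omega$, $\varphi_0<f$, such that $\int(f-\varphi)\,\mathrm{MA}_\omega(\varphi)\le\varepsilon$ for all $\varphi\in\mathcal D_\omega$ with $\varphi_0\le\varphi<f$. A *quasi-metric* is a nonnegative function $\delta$ of two variables that separates points ($\delta(x,y)=0\Leftrightarrow x=y$) and is symmetric, and satisfies the triangle inequality, up to multiplicative constants. The *Dirichlet quasi-metric* of $\mathcal M^1_\omega$ is $\delta_\omega(\mu,\nu)=\lim J_\omega(\mu,\psi)$, the limit being taken over $\psi\in\mathcal D_\omega$ with $J_\omega(\nu,\psi)\to 0$. It is well defined: it is a quasi-metric, and it is the unique function on $\mathcal M^1_\omega\times\mathcal M^1_\omega$ that is continuous for the strong topology and satisfies $\delta_\omega(\mathrm{MA}_\omega(\varphi),\mathrm{MA}_\omega(\psi))=J_\omega(\varphi,\psi)$ for all $\varphi,\psi\in\mathcal D_\omega$ (where $\mathrm{MA}_\omega(\varphi),\mathrm{MA}_\omega(\psi)\in\mathcal M^1_\omega$). **Statement.** There is a constant $C>0$ depending only on $n$ such that, in every such setup, the formula $$d_\omega(\mu,\nu)=\sup\Big\{\Big|\int\varphi\,(\mu-\nu)\Big|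 \;:\; \varphi\in\mathcal D_\omega,\ J_\omega(\varphi)\le 1\Big\}$$ defines a (finite valued) complete metric on $\mathcal M^1_\omega$ whose topology is the strong topology. Furthermore: (i) $d_\omega$ and the Dirichlet quasi-metric $\delta_\omega$ have the same bounded sets; (ii) they are Hölder equivalent on bounded sets: for all $R\ge1$ and $\mu,\nu\in\mathcal M^1_\omega$ with $J_\omega(\mu),J_\omega(\nu)\le R$, $$d_\omega(\mu,\nu)\le C\,\delta_\omega(\mu,\nu)^{1/2}R^{1/2}\quad\text{and}\quad\delta_\omega(\mu,\nu)\le C\,d_\omega(\mu,\nu)\,R^{1/2};$$ (iii) for all $\varphi\in\mathcal D_\omega$ and $\mu,\nu\in\mathcal M^1_\omega$, $$\Big|\int\varphi\,(\mu-\nu)\Big|\le C\,\big(J_\omega(\varphi)^{1/2}+1\big)\,d_\omega(\mu,\nu).$$ -/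

import Mathlib

open Filter Topology
open scoped ENNReal

noncomputable section

/-- The finest vector space topology of a real vector space `V`: a set is open iff its preimage
under each linear map `ℝᵏ → V` is open, that is, iff its trace on each finite dimensional subspace
is open in the canonical topology of that subspace. -/
@[reducible] def finestTopology (V : Type*) [AddCommGroup V] [Module ℝ V] : TopologicalSpace V :=
  ⨆ (k : ℕ) (L : (Fin k → ℝ) →ₗ[ℝ] V),
    TopologicalSpace.coinduced L (inferInstance : TopologicalSpace (Fin k → ℝ))

/-- The space `C⁰(X)^∨` of signed Radon measures on a compact Hausdorff space `X`, i.e. of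
continuous linear forms on `C⁰(X)`, with the weak topology. The integral of `f` against `μ`
is `μ f`. -/
abbrev SignedRadon (X : Type*) [TopologicalSpace X] [CompactSpace X] : Type _ :=
  WeakDual ℝ C(X, ℝ)

/-- Positive Radon measures. -/
def SignedRadon.IsPositive {X : Type*} [TopologicalSpace X] [CompactSpace X]
    (μ : SignedRadon X) : Prop :=
  ∀ f : C(X, ℝ), 0 ≤ f → 0 ≤ μ f

/-- Radon probability measures. -/
def SignedRadon.IsProbability {X : Type*} [TopologicalSpace X] [CompactSpace X]
    (μ : SignedRadon X) : Prop :=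
  μ.IsPositive ∧ μ 1 = 1

/-- Quasi-metrics on a set. -/
structure IsQuasiMetric {M : Type*} (d : M → M → ℝ) : Prop where
  nonneg : ∀ x y, 0 ≤ d x y
  quasi_symm : ∃ C : ℝ, 0 < C ∧ ∀ x y, C⁻¹ * d x y ≤ d y x ∧ d y x ≤ C * d x y
  quasi_triangle : ∃ C : ℝ, 0 < C ∧ ∀ x y z, d x y ≤ C * (d x z + d z y)
  separates : ∀ x y, d x y = 0 ↔ x = y

/-- The data of synthetic pluripotential theory on a compact Hausdorff space `X`, with `Z` the
partially ordered vector space of closed `(1,1)`-forms, and `n` the dimension. -/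
structure PluriData (X : Type*) [TopologicalSpace X] [CompactSpace X]
    (Z : Type*) [AddCommGroup Z] [Module ℝ Z] [PartialOrder Z] (n : ℕ) where
  /-- Test functions. -/
  D : Submodule ℝ C(X, ℝ)
  dense_D : Dense (D : Set C(X, ℝ))
  one_mem : (1 : C(X, ℝ)) ∈ D
  /-- The partial order of `Z` is nice: the positive cone spans `Z` and is closed. -/
  span_nonneg : Submodule.span ℝ {θ : Z | 0 ≤ θ} = ⊤
  closed_nonneg : IsClosed[finestTopology Z] {θ : Z | 0 ≤ θ}
  ddc : D →ₗ[ℝ] Z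
  ddc_one : ddc ⟨1, one_mem⟩ = 0
  /-- The measure `θ₁ ∧ ⋯ ∧ θₙ`. -/
  wedge : MultilinearMap ℝ (fun _ : Fin n => Z) (SignedRadon X)
  wedge_ne_zero : wedge ≠ 0
  wedge_symm : ∀ (σ : Equiv.Perm (Fin n)) (θ : Fin n → Z), wedge (fun i => θ (σ i)) = wedge θ
  wedge_pos : ∀ θ : Fin n → Z, (∀ i, 0 ≤ θ i) → (wedge θ).IsPositive
  /-- Integration by parts; the `i`-th entry of `θ` is replaced, hence irrelevant. -/
  wedge_ddc_symm : ∀ (θ : Fin n → Z) (i : Fin n) (φ ψ : D),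
    wedge (Function.update θ i (ddc ψ)) (φ : C(X, ℝ)) =
      wedge (Function.update θ i (ddc φ)) (ψ : C(X, ℝ))
  wedge_ddc_nonpos : ∀ (θ : Fin n → Z) (i : Fin n) (φ : D), (∀ j, 0 ≤ θ j) →
    wedge (Function.update θ i (ddc φ)) (φ : C(X, ℝ)) ≤ 0

namespace PluriData

variable {X : Type*} [TopologicalSpace X] [CompactSpace X]
  {Z : Type*} [AddCommGroup Z] [Module ℝ Z] [PartialOrder Z] {n : ℕ}

/-- Bott–Chern cohomology `Z / ddᶜ D`. -/
abbrev HBC (S : PluriData X Z n) : Type _ := Z ⧸ LinearMap.range S.ddc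

/-- The positive cone of `HBC`, as the interior of the image of the cone of forms `θ ≥ 0`. -/
def posCone (S : PluriData X Z n) : Set S.HBC :=
  @interior _ (finestTopology S.HBC) ((LinearMap.range S.ddc).mkQ '' {θ : Z | 0 ≤ θ})

/-- The space `D_θ` of `θ`-plurisubharmonic test functions. -/
def psh (S : PluriData X Z n) (θ : Z) : Set S.D := {φ | 0 ≤ θ + S.ddc φ}

/-- The volume `V_ω = ∫ ωⁿ`. -/
def vol (S : PluriData X Z n) (ω : Z) : ℝ := S.wedge (fun _ => ω) 1

/-- The Monge–Ampère operator `MA_ω(φ) = V_ω⁻¹ (ω + ddᶜ φ)ⁿ`. -/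
def MA (S : PluriData X Z n) (ω : Z) (φ : S.D) : SignedRadon X :=
  (S.vol ω)⁻¹ • S.wedge (fun _ => ω + S.ddc φ)

/-- The Monge–Ampère energy
`E_ω(φ) = (n+1)⁻¹ ∑_{j=0}^n V_ω⁻¹ ∫ φ (ω + ddᶜ φ)ʲ ∧ ωⁿ⁻ʲ`. -/
def mongeAmpereEnergy (S : PluriData X Z n) (ω : Z) (φ : S.D) : ℝ :=
  ((n : ℝ) + 1)⁻¹ * ∑ j ∈ Finset.range (n + 1), (S.vol ω)⁻¹ *
    S.wedge (fun i : Fin n => if (i : ℕ) < j then ω + S.ddc φ else ω) (φ : C(X, ℝ))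

/-- The Dirichlet functional
`J_ω(φ, ψ) = E_ω(φ) - E_ω(ψ) + ∫ (ψ - φ) MA_ω(φ)`. -/
def dirichlet (S : PluriData X Z n) (ω : Z) (φ ψ : S.D) : ℝ :=
  S.mongeAmpereEnergy ω φ - S.mongeAmpereEnergy ω ψ + S.MA ω φ ((ψ : C(X, ℝ)) - (φ : C(X, ℝ)))

/-- `J_ω(φ) = J_ω(0, φ)`. -/
def potentialEnergy (S : PluriData X Z n) (ω : Z) (φ : S.D) : ℝ := S.dirichlet ω 0 φ

/-- The energy of a measure `μ` relative to `ψ`,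
`J_ω(μ, ψ) = sup_{φ ∈ D_ω} (E_ω(φ) - E_ω(ψ) + ∫ (ψ - φ) μ)`. -/
def relEnergy (S : PluriData X Z n) (ω : Z) (μ : SignedRadon X) (ψ : S.D) : EReal :=
  ⨆ φ : S.psh ω, ((S.mongeAmpereEnergy ω (φ : S.D) - S.mongeAmpereEnergy ω ψ
    + μ ((ψ : C(X, ℝ)) - ((φ : S.D) : C(X, ℝ))) : ℝ) : EReal)

/-- The energy `J_ω(μ) = J_ω(μ, 0)` of a measure. -/
def energy (S : PluriData X Z n) (ω : Z) (μ : SignedRadon X) : EReal := S.relEnergy ω μ 0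

/-- The space `M¹_ω` of (probability) measures of finite energy. -/
structure FiniteEnergyMeasure (S : PluriData X Z n) (ω : Z) where
  toRadon : SignedRadon X
  isProbability : toRadon.IsProbability
  energy_lt_top : S.energy ω toRadon < ⊤

/-- The real number `J_ω(μ)`, for `μ` of finite energy. -/
def FiniteEnergyMeasure.J {S : PluriData X Z n} {ω : Z} (μ : S.FiniteEnergyMeasure ω) : ℝ :=
  (S.energy ω μ.toRadon).toReal

/-- The strong topology of `M¹_ω`: the coarsest refinement of the weak topology in which the
energy is continuous. -/
@[reducible] def strongTopology (S : PluriData X Z n) (ω : Z) : TopologicalSpace (S.FiniteEnergyMeasure ω) :=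
  TopologicalSpace.induced FiniteEnergyMeasure.toRadon inferInstance ⊓
    TopologicalSpace.induced FiniteEnergyMeasure.J inferInstance

instance (S : PluriData X Z n) (ω : Z) : TopologicalSpace (S.FiniteEnergyMeasure ω) :=
  S.strongTopology ω

/-- `D_ω` admits maxima. -/
def AdmitsMaxima (S : PluriData X Z n) (ω : Z) : Prop :=
  ∀ φ ∈ S.psh ω, ∀ ψ ∈ S.psh ω, ∀ f : S.D,
    (∀ x, max ((φ : C(X, ℝ)) x) ((ψ : C(X, ℝ)) x) < (f : C(X, ℝ)) x) →
    ∃ τ ∈ S.psh ω, ∀ x, max ((φ : C(X, ℝ)) x) ((ψ : C(X, ℝ)) x) ≤ (τ : C(X, ℝ)) x ∧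
      (τ : C(X, ℝ)) x < (f : C(X, ℝ)) x

/-- The orthogonality property. -/
def Orthogonality (S : PluriData X Z n) (ω : Z) : Prop :=
  S.AdmitsMaxima ω ∧
  ∀ f : S.D, ∀ ε : ℝ, 0 < ε →
    ∃ φ₀ ∈ S.psh ω, (∀ x, (φ₀ : C(X, ℝ)) x < (f : C(X, ℝ)) x) ∧
      ∀ φ ∈ S.psh ω, (∀ x, (φ₀ : C(X, ℝ)) x ≤ (φ : C(X, ℝ)) x) →
        (∀ x, (φ : C(X, ℝ)) x < (f : C(X, ℝ)) x) →
        S.MA ω φ ((f : C(X, ℝ)) - (φ : C(X, ℝ))) ≤ ε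

/-- The Dirichlet quasi-metric on `M¹_ω`: `δ_ω(μ, ν)` is the limit of `J_ω(μ, ψ)` when `ψ ∈ D_ω`
is maximizing for `ν`, i.e. when `J_ω(ν, ψ)` tends to `0`. -/
def dirichletQM (S : PluriData X Z n) (ω : Z) (μ ν : S.FiniteEnergyMeasure ω) : ℝ :=
  limUnder (comap (fun ψ : S.psh ω => S.relEnergy ω ν.toRadon ψ) (𝓝 0))
    (fun ψ : S.psh ω => (S.relEnergy ω μ.toRadon ψ).toReal)

/-- The supremum of `|∫ φ (μ - ν)|` over all `φ ∈ D_ω` with `J_ω(φ) ≤ 1`. -/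
def dualDist (S : PluriData X Z n) (ω : Z) (μ ν : S.FiniteEnergyMeasure ω) : ℝ≥0∞ :=
  ⨆ φ : {φ : S.D // φ ∈ S.psh ω ∧ S.potentialEnergy ω φ ≤ 1},
    ENNReal.ofReal |μ.toRadon (φ.1 : C(X, ℝ)) - ν.toRadon (φ.1 : C(X, ℝ))|

/-- `δ` is a continuous function on `M¹_ω × M¹_ω` (for the strong topology) such that
`δ (MA_ω(φ), MA_ω(ψ)) = J_ω(φ, ψ)` for all `φ, ψ ∈ D_ω`. -/
def ExtendsDirichlet (S : PluriData X Z n) (ω : Z)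
    (δ : S.FiniteEnergyMeasure ω → S.FiniteEnergyMeasure ω → ℝ) : Prop :=
  Continuous (fun p : S.FiniteEnergyMeasure ω × S.FiniteEnergyMeasure ω => δ p.1 p.2) ∧
  ∀ φ ∈ S.psh ω, ∀ ψ ∈ S.psh ω, ∃ μ ν : S.FiniteEnergyMeasure ω,
    μ.toRadon = S.MA ω φ ∧ ν.toRadon = S.MA ω ψ ∧ δ μ ν = S.dirichlet ω φ ψ

end PluriData

end

noncomputable section

set_option linter.unusedSectionVars false

/-! ### Positive linear forms on `C(X, ℝ)`. -/

namespace SignedRadon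

variable {X : Type*} [TopologicalSpace X] [CompactSpace X]

/-! The functional J(a, b) is the Bregman divergence of the concave energy E, and the first half of
the proof compares it with Dirichlet norms. By integration by parts, -∫ u ddᶜu ∧ θ₂ ∧ ⋯ ∧ θₙ is, for
positive θᵢ, the square of a seminorm that grows with the θᵢ and obeys Cauchy–Schwarz. The forms ω_a
and ω_b are at most 2 ω_m for the midpoint m of a and b, so J(a, b) is comparable, with constants
depending on n only, to the squared norm of a - b relative to ω_m^(n-1), called `distSq`. The same
quantity bounds the concavity defect of E at m from below (`distSq_le_energy_mid`). Hence
quasi-symmetry, the quasi-triangle inequality and, for psh test functions, the bound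
`abs_MA_sub_psh_le` on differences of Monge–Ampère measures.

For a measure μ of finite energy, J(μ, ·) is -E plus an affine function. Uniform concavity then
makes almost maximizing potentials of μ Cauchy for `distSq`. Orthogonality, applied to the obstacle
ψ + t f, amounts to differentiating the supremum defining J(μ): the Monge–Ampère measures of
maximizing potentials converge weakly to μ (`tendsto_MA_apply`). Estimates for potentials thus pass
to measures, with errors depending only on energies and on J(μ, ψ). This gives existence, continuity
and uniqueness of δ.

The dual distance d is compared with δ in two ways. Cauchy–Schwarz gives d ≲ δ^(1/2) R^(1/2)
(`dualDist_le_sqrt_dirichletQM`). In the other direction, E cancels from J(μ, ψ) + J(ν, φ) - J(ν, ψ)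
- J(μ, φ), which leaves the integral of ψ - φ against μ - ν, linear in d
(`dirichletQM_le_dualDist`). With ν = MA(0) the latter bounds the energy by d. The topology of d is
the strong one because the condition J(ν, ψ) < η on ν is strongly open. Completeness follows from
weak compactness and lower semicontinuity. -/

lemma add_apply (μ ν : SignedRadon X) (f : C(X, ℝ)) : (μ + ν) f = μ f + ν f := rfl

lemma sub_apply (μ ν : SignedRadon X) (f : C(X, ℝ)) : (μ - ν) f = μ f - ν f := rfl

lemma smul_apply (c : ℝ) (μ : SignedRadon X) (f : C(X, ℝ)) : (c • μ) f = c * μ f := rfl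

lemma IsPositive.mono {μ : SignedRadon X} (hμ : μ.IsPositive) {f g : C(X, ℝ)} (h : f ≤ g) :
    μ f ≤ μ g := by
  have := hμ (g - f) (sub_nonneg.2 h)
  rw [map_sub] at this
  linarith

lemma IsPositive.abs_le {μ : SignedRadon X} (hμ : μ.IsPositive) (f : C(X, ℝ)) :
    |μ f| ≤ ‖f‖ * μ 1 := by
  have h1 : f ≤ ‖f‖ • (1 : C(X, ℝ)) := fun x => by
    simpa using (le_abs_self _).trans (f.norm_coe_le_norm x)
  have h2 : -(‖f‖ • (1 : C(X, ℝ))) ≤ f := fun x => by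
    simpa using neg_le_of_abs_le (f.norm_coe_le_norm x)
  have h3 := hμ.mono h1
  have h4 := hμ.mono h2
  rw [map_neg, map_smul, smul_eq_mul] at h4
  rw [map_smul, smul_eq_mul] at h3
  exact _root_.abs_le.2 ⟨h4, h3⟩

lemma IsProbability.abs_le {μ : SignedRadon X} (hμ : μ.IsProbability) (f : C(X, ℝ)) :
    |μ f| ≤ ‖f‖ := by
  simpa [hμ.2] using hμ.1.abs_le f

end SignedRadon

namespace PluriData

open Function (update)

variable {X : Type*} [TopologicalSpace X] [CompactSpace X]
  {Z : Type*} [AddCommGroup Z] [Module ℝ Z] [PartialOrder Z] {n : ℕ}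

/-! ### Dirichlet forms: Cauchy–Schwarz and monotonicity in the forms. -/

section Wedge

variable (S : PluriData X Z n)

lemma wedge_update_add (θ : Fin n → Z) (i : Fin n) (a b : Z) (f : C(X, ℝ)) :
    S.wedge (update θ i (a + b)) f = S.wedge (update θ i a) f + S.wedge (update θ i b) f := by
  rw [S.wedge.map_update_add, SignedRadon.add_apply]

lemma wedge_update_sub (θ : Fin n → Z) (i : Fin n) (a b : Z) (f : C(X, ℝ)) :
    S.wedge (update θ i (a - b)) f = S.wedge (update θ i a) f - S.wedge (update θ i b) f := by
  rw [S.wedge.map_update_sub, SignedRadon.sub_apply]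

lemma wedge_update_smul (θ : Fin n → Z) (i : Fin n) (c : ℝ) (a : Z) (f : C(X, ℝ)) :
    S.wedge (update θ i (c • a)) f = c * S.wedge (update θ i a) f := by
  rw [S.wedge.map_update_smul, SignedRadon.smul_apply]

lemma wedge_swap (θ : Fin n → Z) (i j : Fin n) :
    S.wedge (fun k => θ (Equiv.swap i j k)) = S.wedge θ :=
  S.wedge_symm (Equiv.swap i j) θ

lemma wedge_update_ddc_one (θ : Fin n → Z) (i : Fin n) (u : S.D) :
    S.wedge (update θ i (S.ddc u)) 1 = 0 := by
  have h := S.wedge_ddc_symm θ i ⟨1, S.one_mem⟩ u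
  rw [S.ddc_one] at h
  rw [h, ← zero_smul ℝ (0 : Z), wedge_update_smul, zero_mul]

/-- The Dirichlet form `(u, v) ↦ -∫ u ddᶜ v ∧ ⋀_{j ≠ i} θ j`. -/
def dform (θ : Fin n → Z) (i : Fin n) : LinearMap.BilinForm ℝ S.D :=
  LinearMap.mk₂ ℝ (fun u v => -S.wedge (update θ i (S.ddc v)) (u : C(X, ℝ)))
    (fun u u' v => by simp only [Submodule.coe_add, map_add]; ring)
    (fun c u v => by simp only [Submodule.coe_smul, map_smul, smul_eq_mul]; ring)
    (fun u v v' => by simp only [map_add, wedge_update_add]; ring)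
    (fun c u v => by simp only [map_smul, wedge_update_smul, smul_eq_mul]; ring)

lemma dform_apply (θ : Fin n → Z) (i : Fin n) (u v : S.D) :
    S.dform θ i u v = -S.wedge (update θ i (S.ddc v)) (u : C(X, ℝ)) := rfl

lemma dform_update (θ : Fin n → Z) (i : Fin n) (a : Z) : S.dform (update θ i a) i = S.dform θ i := by
  ext u v
  simp [dform_apply]

lemma dform_comm (θ : Fin n → Z) (i : Fin n) (u v : S.D) : S.dform θ i u v = S.dform θ i v u := by
  rw [dform_apply, dform_apply, S.wedge_ddc_symm]

lemma dform_congr {θ θ' : Fin n → Z} {i : Fin n} (h : ∀ j, j ≠ i → θ j = θ' j) :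
    S.dform θ i = S.dform θ' i := by
  rw [← S.dform_update θ i (θ' i)]
  congr 1
  ext j
  by_cases hj : j = i
  · subst hj; simp
  · simp [hj, h j hj]

lemma dform_self_nonneg {θ : Fin n → Z} {i : Fin n} (h : ∀ j, j ≠ i → 0 ≤ θ j) (u : S.D) :
    0 ≤ S.dform θ i u u := by
  rw [← S.dform_update θ i 0, dform_apply]
  have := S.wedge_ddc_nonpos (update θ i 0) i u fun j => by
    by_cases hj : j = i
    · subst hj; simp
    · simpa [hj] using h j hj
  linarith

lemma abs_dform_le {θ : Fin n → Z} {i : Fin n} (h : ∀ j, j ≠ i → 0 ≤ θ j) (u v : S.D) :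
    |S.dform θ i u v| ≤ √(S.dform θ i u u) * √(S.dform θ i v v) := by
  rw [← Real.sqrt_mul (S.dform_self_nonneg h u), ← Real.sqrt_sq_eq_abs]
  apply Real.sqrt_le_sqrt
  have := LinearMap.BilinForm.apply_mul_apply_le_of_forall_zero_le (S.dform θ i)
    (S.dform_self_nonneg h) u v
  rw [S.dform_comm θ i v u] at this
  rw [sq]
  exact this

lemma dform_const_eq (a : Z) (i j : Fin n) : S.dform (fun _ => a) i = S.dform (fun _ => a) j := by
  ext u v
  rw [dform_apply, dform_apply, ← S.wedge_swap _ i j]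
  congr 3
  ext k
  by_cases hk : k = j
  · subst hk; simp
  · by_cases hk' : k = i
    · subst hk'
      rw [Equiv.swap_apply_left, Function.update_of_ne (Ne.symm hk), Function.update_of_ne hk]
    · rw [Equiv.swap_apply_of_ne_of_ne hk' hk, Function.update_of_ne hk, Function.update_of_ne hk']

lemma dform_smul (c : ℝ) (θ : Fin n → Z) (i : Fin n) (u v : S.D) :
    S.dform (c • θ) i u v = c ^ (n - 1) * S.dform θ i u v := by
  rw [dform_apply, dform_apply, S.wedge.map_update_smul_left, SignedRadon.smul_apply]
  simp

/-- Entries are replaced one at a time. Each replacement changes the value by a Dirichlet form with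
`θ' j - θ j` in slot `j`, which is nonnegative because all its entries are. -/
lemma dform_mono [IsOrderedAddMonoid Z] {θ θ' : Fin n → Z} {i : Fin n}
    (h0 : ∀ j, j ≠ i → 0 ≤ θ j) (h : ∀ j, j ≠ i → θ j ≤ θ' j) (u : S.D) :
    S.dform θ i u u ≤ S.dform θ' i u u := by
  suffices H : ∀ s : Finset (Fin n), S.dform θ i u u ≤ S.dform (s.piecewise θ' θ) i u u by
    simpa using H Finset.univ
  intro s
  induction s using Finset.induction_on with
  | empty => simp
  | insert j s hj ih =>
    refine ih.trans ?_
    rw [Finset.piecewise_insert]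
    by_cases hji : j = i
    · subst hji; rw [dform_update]
    · have hη : update (s.piecewise θ' θ) j (θ j) = s.piecewise θ' θ := by
        simp [hj]
      have key := S.dform_self_nonneg (θ := update (s.piecewise θ' θ) j (θ' j - θ j)) (i := i)
        (fun k hk => by
          by_cases hkj : k = j
          · subst hkj; simpa using h k hk
          · rw [Function.update_of_ne hkj]
            by_cases hks : k ∈ s
            · simpa [hks] using (h0 k hk).trans (h k hk)
            · simpa [hks] using h0 k hk) u
      rw [dform_apply, Function.update_comm hji, wedge_update_sub] at key
      conv_lhs => rw [← hη]
      rw [dform_apply, dform_apply, Function.update_comm hji, Function.update_comm hji]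
      linarith

lemma wedge_mono [IsOrderedAddMonoid Z] {θ θ' : Fin n → Z}
    (h0 : ∀ j, 0 ≤ θ j) (h : ∀ j, θ j ≤ θ' j) : S.wedge θ 1 ≤ S.wedge θ' 1 := by
  suffices H : ∀ s : Finset (Fin n), S.wedge θ 1 ≤ S.wedge (s.piecewise θ' θ) 1 by
    simpa using H Finset.univ
  intro s
  induction s using Finset.induction_on with
  | empty => simp
  | insert j s hj ih =>
    refine ih.trans ?_
    rw [Finset.piecewise_insert]
    have hη : update (s.piecewise θ' θ) j (θ j) = s.piecewise θ' θ := by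
      simp [hj]
    have key := S.wedge_pos (update (s.piecewise θ' θ) j (θ' j - θ j)) (fun k => by
        by_cases hkj : k = j
        · subst hkj; simpa using h k
        · rw [Function.update_of_ne hkj]
          by_cases hks : k ∈ s
          · simpa [hks] using (h0 k).trans (h k)
          · simpa [hks] using h0 k) 1 zero_le_one
    rw [wedge_update_sub] at key
    conv_lhs => rw [← hη]
    linarith

/-- Total masses depend only on classes modulo `ddᶜ`: an exact entry contributes nothing, by
integration by parts against the constant 1. -/
lemma wedge_add_ddc_one (θ : Fin n → Z) (u : Fin n → S.D) :
    S.wedge (fun i => θ i + S.ddc (u i)) 1 = S.wedge θ 1 := by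
  suffices H : ∀ s : Finset (Fin n),
      S.wedge (s.piecewise (fun i => θ i + S.ddc (u i)) θ) 1 = S.wedge θ 1 by
    simpa using H Finset.univ
  intro s
  induction s using Finset.induction_on with
  | empty => simp
  | insert j s hj ih =>
    rw [Finset.piecewise_insert, wedge_update_add, wedge_update_ddc_one, add_zero, ← ih]
    congr 2
    simp [hj]

end Wedge

/-! ### Consequences of the class of `ω` being interior to the positive cone. -/

section Volume

variable (S : PluriData X Z n)

/-- Every form is dominated, up to a positive factor and modulo `ddᶜ`, by a form whose class is
in the positive cone. -/
lemma exists_smul_le_of_mem_posCone {ω : Z}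
    (h : (LinearMap.range S.ddc).mkQ ω ∈ S.posCone) (θ : Z) :
    ∃ c : ℝ, 0 < c ∧ ∃ u : S.D, 0 ≤ ω + S.ddc u - c • θ := by
  set q := (LinearMap.range S.ddc).mkQ
  -- Linear maps from ℝ² are continuous for the finest topology, so the preimage of the open cone is
  -- open. It contains (1, 0), hence also (1, -t) for small t > 0.
  set L : (Fin 2 → ℝ) →ₗ[ℝ] S.HBC :=
    (LinearMap.proj 0).smulRight (q ω) + (LinearMap.proj 1).smulRight (q θ)
  have hL : Continuous[inferInstance, finestTopology S.HBC] L := by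
    rw [continuous_iff_coinduced_le]
    exact le_iSup₂_of_le 2 L le_rfl
  have hopen : IsOpen (L ⁻¹' S.posCone) :=
    @IsOpen.preimage _ _ _ (finestTopology S.HBC) _ hL _
      (@isOpen_interior _ (finestTopology S.HBC) _)
  have hc : Continuous fun t : ℝ => (![1, -t] : Fin 2 → ℝ) := by fun_prop
  have h0 : (0 : ℝ) ∈ (fun t : ℝ => (![1, -t] : Fin 2 → ℝ)) ⁻¹' (L ⁻¹' S.posCone) := by
    simpa [L] using h
  obtain ⟨c, hc0, hc⟩ := Metric.isOpen_iff.1 (hopen.preimage hc) 0 h0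
  have hm := hc (show c / 2 ∈ Metric.ball (0 : ℝ) c by
    rw [Metric.mem_ball, Real.dist_eq, sub_zero, abs_of_pos (by linarith)]; linarith)
  obtain ⟨η, hη, hηq⟩ := @interior_subset _ (finestTopology S.HBC) _ _ hm
  refine ⟨c / 2, by linarith, ?_⟩
  have h1 : q η = q (ω - (c / 2) • θ) := by
    rw [hηq]; simp [L, sub_eq_add_neg]
  have h2 : η - (ω - (c / 2) • θ) ∈ LinearMap.range S.ddc :=
    (Submodule.Quotient.eq _).1 h1
  obtain ⟨u, hu⟩ := h2
  refine ⟨u, ?_⟩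
  rw [hu]
  convert (show (0 : Z) ≤ η from hη) using 1
  abel

/-- Otherwise all products of positive forms are positive measures of mass zero, hence zero. Since
positive forms span `Z`, multilinearity would make the whole wedge product vanish. -/
lemma exists_wedge_one_pos : ∃ θ : Fin n → Z, (∀ i, 0 ≤ θ i) ∧ 0 < S.wedge θ 1 := by
  by_contra! H
  apply S.wedge_ne_zero
  have hpos : ∀ θ : Fin n → Z, (∀ i, 0 ≤ θ i) → S.wedge θ = 0 := by
    intro θ hθ
    have hp := S.wedge_pos θ hθ
    have h1 : S.wedge θ 1 = 0 := le_antisymm (H θ hθ) (hp 1 zero_le_one)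
    apply DFunLike.ext
    intro f
    have := hp.abs_le f
    rw [h1, mul_zero] at this
    exact abs_eq_zero.1 (le_antisymm this (abs_nonneg _))
  -- `s` is the set of entries already freed from the positivity constraint.
  have key : ∀ s : Finset (Fin n), ∀ θ : Fin n → Z, (∀ i, i ∉ s → 0 ≤ θ i) → S.wedge θ = 0 := by
    intro s
    induction s using Finset.induction_on with
    | empty => intro θ hθ; exact hpos θ fun i => hθ i (by simp)
    | insert j s hj ih =>
      intro θ hθ
      have h2 : ∀ a : Z, S.wedge (update θ j a) = 0 := by
        intro a
        have ha : a ∈ Submodule.span ℝ {θ : Z | 0 ≤ θ} := by rw [S.span_nonneg]; trivial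
        induction ha using Submodule.span_induction with
        | mem a ha =>
          apply ih
          intro i hi
          by_cases hij : i = j
          · subst hij; simpa using ha
          · rw [Function.update_of_ne hij]; exact hθ i (by simp [hij, hi])
        | zero => exact S.wedge.map_coord_zero j (by simp)
        | add a b _ _ ha hb => rw [S.wedge.map_update_add, ha, hb, add_zero]
        | smul c a _ ha => rw [S.wedge.map_update_smul, ha, smul_zero]
      simpa using h2 (θ j)
  ext1 θ
  simpa using key Finset.univ θ (by simp)

/-- Each factor of a product of positive mass is dominated, up to scaling and `ddᶜ`, by `ω`; masses
are monotone and cohomological. -/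
lemma vol_pos [IsOrderedAddMonoid Z] [IsOrderedModule ℝ Z] {ω : Z}
    (h : (LinearMap.range S.ddc).mkQ ω ∈ S.posCone) : 0 < S.vol ω := by
  obtain ⟨θ, hθ, hpos⟩ := S.exists_wedge_one_pos
  choose c hc u hu using fun i => S.exists_smul_le_of_mem_posCone h (θ i)
  have h1 : S.wedge (fun i => c i • θ i) 1 ≤ S.wedge (fun i => ω + S.ddc (u i)) 1 :=
    S.wedge_mono (fun j => smul_nonneg (hc j).le (hθ j)) (fun j => sub_nonneg.1 (hu j))
  rw [S.wedge_add_ddc_one (fun _ => ω) u, S.wedge.map_smul_univ, SignedRadon.smul_apply] at h1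
  exact (mul_pos (Finset.prod_pos fun i _ => hc i) hpos).trans_le h1

/-- Every test function is a multiple of a difference of `ω`-psh test functions. -/
lemma exists_psh_sub [IsOrderedAddMonoid Z] [IsOrderedModule ℝ Z] {ω : Z}
    (h : (LinearMap.range S.ddc).mkQ ω ∈ S.posCone) (f : S.D) :
    ∃ s : ℝ, 0 < s ∧ ∃ g₁ ∈ S.psh ω, ∃ g₂ ∈ S.psh ω, f = s • (g₁ - g₂) := by
  have hspan : ∀ z : Z, ∃ a b : Z, 0 ≤ a ∧ 0 ≤ b ∧ z = a - b := by
    intro z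
    have hz : z ∈ Submodule.span ℝ {θ : Z | 0 ≤ θ} := by rw [S.span_nonneg]; trivial
    induction hz using Submodule.span_induction with
    | mem a ha => exact ⟨a, 0, ha, le_rfl, by simp⟩
    | zero => exact ⟨0, 0, le_rfl, le_rfl, by simp⟩
    | add x y _ _ hx hy =>
      obtain ⟨a, b, ha, hb, rfl⟩ := hx
      obtain ⟨a', b', ha', hb', rfl⟩ := hy
      exact ⟨a + a', b + b', add_nonneg ha ha', add_nonneg hb hb', by abel⟩
    | smul c x _ hx =>
      obtain ⟨a, b, ha, hb, rfl⟩ := hx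
      rcases le_total 0 c with hc | hc
      · exact ⟨c • a, c • b, smul_nonneg hc ha, smul_nonneg hc hb, smul_sub _ _ _⟩
      · refine ⟨(-c) • b, (-c) • a, smul_nonneg (by linarith) hb, smul_nonneg (by linarith) ha, ?_⟩
        rw [← smul_sub, neg_smul, ← smul_neg, neg_sub]
  obtain ⟨a, b, ha, hb, hab⟩ := hspan (S.ddc f)
  -- Since `ω + ddᶜ u` dominates `c • b`, it absorbs the negative part of `c • ddᶜ f`: both `u` and
  -- `u + c • f` are `ω`-psh.
  obtain ⟨c, hc, u, hu⟩ := S.exists_smul_le_of_mem_posCone h b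
  refine ⟨c⁻¹, inv_pos.2 hc, u + c • f, ?_, u, ?_, ?_⟩
  · have : ω + S.ddc (u + c • f) = (ω + S.ddc u - c • b) + c • a := by
      rw [map_add, map_smul, hab, smul_sub]; abel
    show 0 ≤ _
    rw [this]
    exact add_nonneg hu (smul_nonneg hc.le ha)
  · show 0 ≤ _
    have : ω + S.ddc u = (ω + S.ddc u - c • b) + c • b := by abel
    rw [this]
    exact add_nonneg hu (smul_nonneg hc.le hb)
  · rw [add_sub_cancel_left, smul_smul, inv_mul_cancel₀ hc.ne', one_smul]

end Volume

end PluriData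

namespace PluriData

open Function (update)

variable {X : Type*} [TopologicalSpace X] [CompactSpace X]
  {Z : Type*} [AddCommGroup Z] [Module ℝ Z] [PartialOrder Z] {n : ℕ}

/-! ### Mixed products of two or three forms, and the cocycle identity behind the energy. -/

section Hybrid

/-- The family with entries `α` (`j` times), followed by `β`. -/
def hyb {Z : Type*} {n : ℕ} (α β : Z) (j : ℕ) : Fin n → Z := fun i => if (i : ℕ) < j then α else β

/-- The family with entries `α` (for `i < p`), then `β` (for `i < q`), followed by `γ`. -/
def hyb₃ {Z : Type*} {n : ℕ} (α β γ : Z) (p q : ℕ) : Fin n → Z :=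
  fun i => if (i : ℕ) < p then α else if (i : ℕ) < q then β else γ

lemma hyb_zero {Z : Type*} (α β : Z) : (hyb α β 0 : Fin n → Z) = fun _ => β := by
  ext i; simp [hyb]

lemma hyb_self {Z : Type*} (α β : Z) : (hyb α β n : Fin n → Z) = fun _ => α := by
  ext i; simp [hyb]

variable (S : PluriData X Z n)

lemma wedge_hyb_succ_sub (α β : Z) (k : Fin n) (f : C(X, ℝ)) :
    S.wedge (hyb α β (k + 1)) f - S.wedge (hyb α β k) f
      = S.wedge (update (hyb α β k) k (α - β)) f := by
  rw [wedge_update_sub]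
  congr 3
  · ext i
    by_cases hi : i = k
    · subst hi; simp [hyb]
    · have : (i : ℕ) ≠ k := fun h => hi (Fin.ext h)
      rw [Function.update_of_ne hi]
      unfold hyb
      congr 1
      simp only [eq_iff_iff]; omega
  · ext i
    by_cases hi : i = k
    · subst hi; simp [hyb]
    · rw [Function.update_of_ne hi]

lemma wedge_const_sub (α β : Z) (f : C(X, ℝ)) :
    S.wedge (fun _ => α) f - S.wedge (fun _ => β) f
      = ∑ k : Fin n, S.wedge (update (hyb α β k) k (α - β)) f := by
  simp_rw [← wedge_hyb_succ_sub]
  rw [Fin.sum_univ_eq_sum_range (fun k => S.wedge (hyb α β (k + 1)) f - S.wedge (hyb α β k) f) n,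
    Finset.sum_range_sub (fun k => S.wedge (hyb α β k) f), hyb_self, hyb_zero]

/-- The first difference is ∫ u ddᶜv ∧ Θ and the second is -∫ v ddᶜu ∧ Θ, with the same Θ up to
order: p copies of α, q - p of β, n - q - 1 of γ. Integration by parts cancels them. -/
lemma wedge_hyb₃_exchange (α β γ : Z) (u v : S.D) (hu : α - β = S.ddc u) (hv : β - γ = S.ddc v)
    {p q : ℕ} (hpq : p ≤ q) (hq : q < n) :
    (S.wedge (hyb₃ α β γ p (q + 1)) (u : C(X, ℝ)) - S.wedge (hyb₃ α β γ p q) (u : C(X, ℝ)))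
      + (S.wedge (hyb₃ α β γ p (q + 1)) (v : C(X, ℝ))
        - S.wedge (hyb₃ α β γ (p + 1) (q + 1)) (v : C(X, ℝ))) = 0 := by
  set P : Fin n := ⟨p, by omega⟩ with hP
  set Q : Fin n := ⟨q, hq⟩ with hQ
  have hne : ∀ {i j : Fin n}, i ≠ j → (i : ℕ) ≠ j := fun h h' => h (Fin.ext h')
  have h1 : (hyb₃ α β γ p (q + 1) : Fin n → Z) = update (hyb₃ α β γ p q) Q β := by
    ext i
    by_cases hi : i = Q
    · subst hi; simp [hyb₃, hQ, hpq]
    · have := hne hi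
      simp only [hQ] at this
      rw [Function.update_of_ne hi]
      simp only [hyb₃]
      congr 2
      simp only [eq_iff_iff]; omega
  have h2 : (hyb₃ α β γ p q : Fin n → Z) = update (hyb₃ α β γ p q) Q γ := by
    ext i
    by_cases hi : i = Q
    · subst hi; simp [hyb₃, hQ, hpq]
    · rw [Function.update_of_ne hi]
  have h3 : (hyb₃ α β γ p (q + 1) : Fin n → Z) = update (hyb₃ α β γ p (q + 1)) P β := by
    ext i
    by_cases hi : i = P
    · subst hi; simp [hyb₃, hP]; omega
    · rw [Function.update_of_ne hi]
  have h4 : (hyb₃ α β γ (p + 1) (q + 1) : Fin n → Z) = update (hyb₃ α β γ p (q + 1)) P α := by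
    ext i
    by_cases hi : i = P
    · subst hi; simp [hyb₃, hP]
    · have := hne hi
      simp only [hP] at this
      rw [Function.update_of_ne hi]
      simp only [hyb₃]
      congr 1
      simp only [eq_iff_iff]; omega
  have h5 : S.wedge (hyb₃ α β γ p (q + 1)) (u : C(X, ℝ)) - S.wedge (hyb₃ α β γ p q) (u : C(X, ℝ))
      = S.wedge (update (hyb₃ α β γ p q) Q (S.ddc v)) (u : C(X, ℝ)) := by
    rw [← hv, wedge_update_sub, ← h1, ← h2]
  have h6 : S.wedge (hyb₃ α β γ p (q + 1)) (v : C(X, ℝ))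
        - S.wedge (hyb₃ α β γ (p + 1) (q + 1)) (v : C(X, ℝ))
      = -S.wedge (update (hyb₃ α β γ p (q + 1)) P (S.ddc u)) (v : C(X, ℝ)) := by
    rw [← hu, wedge_update_sub, ← h3, ← h4]; ring
  have h7 : (update (hyb₃ α β γ p q) Q (S.ddc v) : Fin n → Z)
      = fun k => update (hyb₃ α β γ p (q + 1)) P (S.ddc v) (Equiv.swap P Q k) := by
    ext k
    by_cases hkQ : k = Q
    · subst hkQ; simp
    · by_cases hkP : k = P
      · subst hkP
        rw [Equiv.swap_apply_left, Function.update_of_ne hkQ, Function.update_of_ne (Ne.symm hkQ)]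
        have := hne hkQ
        simp only [hP, hQ] at this
        have h8 : p < q := by omega
        have h9 : ¬ q < p := by omega
        simp [hyb₃, hP, hQ, h8, h9]
      · rw [Equiv.swap_apply_of_ne_of_ne hkP hkQ, Function.update_of_ne hkQ,
          Function.update_of_ne hkP]
        have := hne hkQ
        simp only [hQ] at this
        simp only [hyb₃]
        congr 2
        simp only [eq_iff_iff]; omega
  rw [h5, h6, h7, S.wedge_swap, S.wedge_ddc_symm]
  ring

/-- Moving from (p, n) to (p, p) for `u`, and from (0, q) to (q, q) for `v`, both errors telescope
into sums over the triangle 0 ≤ p ≤ q < n, where they cancel term by term by `wedge_hyb₃_exchange`.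
-/
lemma sum_wedge_hyb_cocycle (α β γ : Z) (u v : S.D) (hu : α - β = S.ddc u)
    (hv : β - γ = S.ddc v) :
    ∑ j ∈ Finset.range (n + 1), S.wedge (hyb α β j) (u : C(X, ℝ))
      + ∑ j ∈ Finset.range (n + 1), S.wedge (hyb β γ j) (v : C(X, ℝ))
      = ∑ j ∈ Finset.range (n + 1), S.wedge (hyb α γ j) ((u : C(X, ℝ)) + v) := by
  have e1 : ∀ p, (hyb α β p : Fin n → Z) = hyb₃ α β γ p n := fun p => by ext i; simp [hyb, hyb₃]
  have e2 : ∀ q, (hyb β γ q : Fin n → Z) = hyb₃ α β γ 0 q := fun p => by ext i; simp [hyb, hyb₃]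
  have e3 : ∀ p, (hyb α γ p : Fin n → Z) = hyb₃ α β γ p p := fun p => by
    ext i; simp only [hyb, hyb₃]; split_ifs <;> rfl
  set w := fun p q => S.wedge (hyb₃ α β γ p q) with hw
  have s1 : ∑ p ∈ Finset.range (n + 1), (w p n (u : C(X, ℝ)) - w p p (u : C(X, ℝ)))
      = ∑ p ∈ Finset.range n, ∑ q ∈ Finset.Ico p n,
          (w p (q + 1) (u : C(X, ℝ)) - w p q (u : C(X, ℝ))) := by
    rw [Finset.sum_range_succ, sub_self, add_zero]
    refine Finset.sum_congr rfl fun p hp => ?_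
    rw [Finset.sum_Ico_sub (fun q => w p q (u : C(X, ℝ))) (Finset.mem_range.1 hp).le]
  have s2 : ∑ q ∈ Finset.range (n + 1), (w 0 q (v : C(X, ℝ)) - w q q (v : C(X, ℝ)))
      = ∑ q ∈ Finset.range n, ∑ p ∈ Finset.range (q + 1),
          (w p (q + 1) (v : C(X, ℝ)) - w (p + 1) (q + 1) (v : C(X, ℝ))) := by
    rw [Finset.sum_range_succ', sub_self, add_zero]
    refine Finset.sum_congr rfl fun q _ => ?_
    rw [Finset.sum_range_sub' (fun p => w p (q + 1) (v : C(X, ℝ)))]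
  have s3 : ∑ p ∈ Finset.range n, ∑ q ∈ Finset.Ico p n,
          (w p (q + 1) (u : C(X, ℝ)) - w p q (u : C(X, ℝ)))
      = ∑ q ∈ Finset.range n, ∑ p ∈ Finset.range (q + 1),
          (w p (q + 1) (u : C(X, ℝ)) - w p q (u : C(X, ℝ))) := by
    refine Finset.sum_comm' fun p q => ?_
    simp only [Finset.mem_range, Finset.mem_Ico]; omega
  have s4 : ∑ p ∈ Finset.range (n + 1), (w p n (u : C(X, ℝ)) - w p p (u : C(X, ℝ)))
      + ∑ q ∈ Finset.range (n + 1), (w 0 q (v : C(X, ℝ)) - w q q (v : C(X, ℝ))) = 0 := by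
    rw [s1, s2, s3, ← Finset.sum_add_distrib]
    refine Finset.sum_eq_zero fun q hq => ?_
    rw [← Finset.sum_add_distrib]
    refine Finset.sum_eq_zero fun p hp => ?_
    exact S.wedge_hyb₃_exchange α β γ u v hu hv
      (Nat.lt_succ_iff.1 (Finset.mem_range.1 hp)) (Finset.mem_range.1 hq)
  simp_rw [map_add, Finset.sum_add_distrib, e1, e2, e3]
  rw [Finset.sum_sub_distrib, Finset.sum_sub_distrib] at s4
  simp only [hw] at s4
  linarith

end Hybrid

/-! ### The Dirichlet functional compared with Dirichlet norms. -/

section Energy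

variable (S : PluriData X Z n) (ω : Z)

lemma mongeAmpereEnergy_eq (φ : S.D) :
    S.mongeAmpereEnergy ω φ = ((n : ℝ) + 1)⁻¹ * ((S.vol ω)⁻¹ *
      ∑ j ∈ Finset.range (n + 1), S.wedge (hyb (ω + S.ddc φ) ω j) (φ : C(X, ℝ))) := by
  rw [Finset.mul_sum]; rfl

lemma mongeAmpereEnergy_zero : S.mongeAmpereEnergy ω 0 = 0 := by
  simp [mongeAmpereEnergy_eq]

/-- The cocycle identity for the forms of φ, ψ and 0 turns the difference of energies into the
energy of φ based at the form of ψ. -/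
lemma mongeAmpereEnergy_sub (φ ψ : S.D) :
    S.mongeAmpereEnergy ω φ - S.mongeAmpereEnergy ω ψ = ((n : ℝ) + 1)⁻¹ * ((S.vol ω)⁻¹ *
      ∑ j ∈ Finset.range (n + 1),
        S.wedge (hyb (ω + S.ddc φ) (ω + S.ddc ψ) j) ((φ : C(X, ℝ)) - ψ)) := by
  have := S.sum_wedge_hyb_cocycle (ω + S.ddc φ) (ω + S.ddc ψ) ω (φ - ψ) ψ
    (by rw [map_sub]; abel) (by abel)
  rw [mongeAmpereEnergy_eq, mongeAmpereEnergy_eq, ← mul_sub, ← mul_sub]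
  simp only [Submodule.coe_sub, sub_add_cancel] at this
  rw [← this]
  ring

lemma MA_apply (φ : S.D) (f : C(X, ℝ)) :
    S.MA ω φ f = (S.vol ω)⁻¹ * S.wedge (fun _ => ω + S.ddc φ) f := rfl

lemma dirichlet_eq (a b : S.D) :
    S.dirichlet ω a b = ((n : ℝ) + 1)⁻¹ * ∑ j ∈ Finset.range (n + 1), (S.vol ω)⁻¹ *
      (S.wedge (hyb (ω + S.ddc a) (ω + S.ddc b) j) ((a : C(X, ℝ)) - b)
        - S.wedge (hyb (ω + S.ddc a) (ω + S.ddc b) n) ((a : C(X, ℝ)) - b)) := by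
  have hn : ((n : ℝ) + 1) ≠ 0 := by positivity
  rw [dirichlet, mongeAmpereEnergy_sub, hyb_self, MA_apply, ← neg_sub (a : C(X, ℝ)) b, map_neg,
    ← Finset.mul_sum, Finset.sum_sub_distrib, Finset.sum_const, Finset.card_range, nsmul_eq_mul]
  push_cast
  field_simp
  ring

lemma dirichlet_add_dirichlet (a b : S.D) :
    S.dirichlet ω a b + S.dirichlet ω b a
      = S.MA ω b ((a : C(X, ℝ)) - b) - S.MA ω a ((a : C(X, ℝ)) - b) := by
  rw [dirichlet, dirichlet, ← neg_sub (a : C(X, ℝ)) b, map_neg]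
  ring

lemma dirichlet_self (a : S.D) : S.dirichlet ω a a = 0 := by simp [dirichlet]

/-- The midpoint of two test functions. -/
def mid (a b : S.D) : S.D := (2⁻¹ : ℝ) • (a + b)

lemma coe_mid (a b : S.D) : (S.mid a b : C(X, ℝ)) = (2⁻¹ : ℝ) • ((a : C(X, ℝ)) + b) := rfl

lemma form_mid (a b : S.D) :
    (2 : ℝ) • (ω + S.ddc (S.mid a b)) = (ω + S.ddc a) + (ω + S.ddc b) := by
  rw [mid, map_smul, smul_add, smul_smul, map_add]
  norm_num
  rw [two_smul]
  abel

lemma mid_comm (a b : S.D) : S.mid a b = S.mid b a := by rw [mid, mid, add_comm]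

/-- An identity valid for every Bregman divergence. All terms on the right being nonnegative on psh
functions, it shows that J(m, b) ≤ J(a, b) for the midpoint m. -/
lemma dirichlet_bregman (a b : S.D) :
    S.dirichlet ω a b = S.dirichlet ω a (S.mid a b) + S.dirichlet ω (S.mid a b) b
      + (S.dirichlet ω a (S.mid a b) + S.dirichlet ω (S.mid a b) a) := by
  simp only [dirichlet, coe_mid, map_sub, map_smul, map_add, smul_eq_mul]
  ring

lemma two_mul_energy_mid (a b : S.D) :
    2 * S.mongeAmpereEnergy ω (S.mid a b) - S.mongeAmpereEnergy ω a - S.mongeAmpereEnergy ω b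
      = S.dirichlet ω (S.mid a b) a + S.dirichlet ω (S.mid a b) b := by
  simp only [dirichlet, coe_mid, map_sub, map_smul, map_add, smul_eq_mul]
  ring

variable {S ω}

variable [IsOrderedAddMonoid Z] [IsOrderedModule ℝ Z]

lemma zero_mem_psh (hω : 0 ≤ ω) : (0 : S.D) ∈ S.psh ω := by simpa [psh] using hω

lemma smul_add_smul_mem_psh {a b : S.D} (ha : a ∈ S.psh ω) (hb : b ∈ S.psh ω) {s t : ℝ}
    (hs : 0 ≤ s) (ht : 0 ≤ t) (hst : s + t = 1) : s • a + t • b ∈ S.psh ω := by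
  show 0 ≤ _
  have : ω + S.ddc (s • a + t • b) = s • (ω + S.ddc a) + t • (ω + S.ddc b) := by
    rw [map_add, map_smul, map_smul, smul_add, smul_add]
    nth_rewrite 1 [← one_smul ℝ ω]
    rw [← hst, add_smul]
    abel
  rw [this]
  exact add_nonneg (smul_nonneg hs ha) (smul_nonneg ht hb)

lemma mid_mem_psh {a b : S.D} (ha : a ∈ S.psh ω) (hb : b ∈ S.psh ω) : S.mid a b ∈ S.psh ω := by
  rw [mid, smul_add]
  exact smul_add_smul_mem_psh ha hb (by norm_num) (by norm_num) (by norm_num)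

lemma smul_mem_psh (hω : 0 ≤ ω) {a : S.D} (ha : a ∈ S.psh ω) {t : ℝ} (ht : 0 ≤ t) (ht' : t ≤ 1) :
    t • a ∈ S.psh ω := by
  simpa using smul_add_smul_mem_psh ha (zero_mem_psh hω) ht (sub_nonneg.2 ht') (by ring)

lemma hyb_nonneg {α β : Z} (hα : 0 ≤ α) (hβ : 0 ≤ β) (j : ℕ) (i : Fin n) :
    0 ≤ hyb α β j i := by
  unfold hyb; split_ifs <;> assumption

lemma wedge_hyb_sub_eq_dform (a b v : S.D) (k : Fin n) :
    S.wedge (hyb (ω + S.ddc a) (ω + S.ddc b) k) (v : C(X, ℝ))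
      - S.wedge (hyb (ω + S.ddc a) (ω + S.ddc b) (k + 1)) (v : C(X, ℝ))
      = S.dform (hyb (ω + S.ddc a) (ω + S.ddc b) k) k v (a - b) := by
  rw [dform_apply, show S.ddc (a - b) = (ω + S.ddc a) - (ω + S.ddc b) by rw [map_sub]; abel,
    ← wedge_hyb_succ_sub]
  ring

/-- Consecutive terms differ by the Dirichlet form of `a - b` with positive entries. -/
lemma wedge_hyb_antitone {a b : S.D} (ha : a ∈ S.psh ω) (hb : b ∈ S.psh ω) {j k : ℕ} (hjk : j ≤ k)
    (hk : k ≤ n) : S.wedge (hyb (ω + S.ddc a) (ω + S.ddc b) k) ((a : C(X, ℝ)) - b)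
      ≤ S.wedge (hyb (ω + S.ddc a) (ω + S.ddc b) j) ((a : C(X, ℝ)) - b) := by
  induction k, hjk using Nat.le_induction with
  | base => exact le_rfl
  | succ k hjk ih =>
    refine le_trans ?_ (ih (by omega))
    have h1 := wedge_hyb_sub_eq_dform (ω := ω) a b (a - b) ⟨k, hk⟩
    have h2 := S.dform_self_nonneg (θ := hyb (ω + S.ddc a) (ω + S.ddc b) k) (i := ⟨k, hk⟩)
      (fun j _ => hyb_nonneg ha hb _ _) (a - b)
    rw [Submodule.coe_sub] at h1
    simp only at h1
    linarith

variable (S ω) in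
/-- The squared Dirichlet norm of `u` with respect to `ω_σ ^ (n - 1)`. -/
def normSq [NeZero n] (σ u : S.D) : ℝ := (S.vol ω)⁻¹ * S.dform (fun _ => ω + S.ddc σ) 0 u u

variable [NeZero n]

lemma normSq_smul (σ u : S.D) (c : ℝ) : S.normSq ω σ (c • u) = c ^ 2 * S.normSq ω σ u := by
  simp only [normSq, map_smul, LinearMap.smul_apply, smul_eq_mul]
  ring

lemma normSq_neg (σ u : S.D) : S.normSq ω σ (-u) = S.normSq ω σ u := by
  simp [normSq]

lemma normSq_nonneg (hV : 0 < S.vol ω) {σ : S.D} (hσ : σ ∈ S.psh ω) (u : S.D) :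
    0 ≤ S.normSq ω σ u :=
  mul_nonneg (inv_nonneg.2 hV.le) (S.dform_self_nonneg (fun _ _ => hσ) u)

lemma dform_le_normSq (hV : 0 < S.vol ω) {θ : Fin n → Z} {i : Fin n} {c : ℝ} {σ : S.D}
    (h0 : ∀ j, j ≠ i → 0 ≤ θ j) (h : ∀ j, j ≠ i → θ j ≤ c • (ω + S.ddc σ)) (u : S.D) :
    (S.vol ω)⁻¹ * S.dform θ i u u ≤ c ^ (n - 1) * S.normSq ω σ u := by
  have h1 := S.dform_mono (θ' := c • fun _ => ω + S.ddc σ) h0 h u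
  rw [dform_smul, S.dform_const_eq _ i 0] at h1
  calc _ ≤ (S.vol ω)⁻¹ * _ := mul_le_mul_of_nonneg_left h1 (inv_nonneg.2 hV.le)
    _ = _ := by rw [normSq]; ring

lemma normSq_le_normSq (hV : 0 < S.vol ω) {c : ℝ} {σ τ : S.D} (hσ : σ ∈ S.psh ω)
    (h : ω + S.ddc σ ≤ c • (ω + S.ddc τ)) (u : S.D) :
    S.normSq ω σ u ≤ c ^ (n - 1) * S.normSq ω τ u :=
  dform_le_normSq hV (fun _ _ => hσ) (fun _ _ => h) u

lemma abs_inv_vol_mul_dform_le (hV : 0 < S.vol ω) {θ : Fin n → Z} {i : Fin n}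
    (h : ∀ j, j ≠ i → 0 ≤ θ j) (u v : S.D) : |(S.vol ω)⁻¹ * S.dform θ i u v| ≤
      √((S.vol ω)⁻¹ * S.dform θ i u u) * √((S.vol ω)⁻¹ * S.dform θ i v v) := by
  have hi := inv_nonneg.2 hV.le
  rw [abs_mul, abs_of_nonneg hi, Real.sqrt_mul hi, Real.sqrt_mul hi]
  calc _ ≤ (S.vol ω)⁻¹ * (_ * _) := mul_le_mul_of_nonneg_left (S.abs_dform_le h _ _) hi
    _ = _ := by
      nth_rewrite 1 [← Real.mul_self_sqrt hi]
      ring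

/-- All summands of `dirichlet_eq` are nonnegative, and only j = 0 is kept. Telescoped from 0 to n,
that summand contains the last step, in which the other n - 1 entries all equal the form of `a`. -/
lemma normSq_le_dirichlet (hV : 0 < S.vol ω) {a b : S.D} (ha : a ∈ S.psh ω) (hb : b ∈ S.psh ω) :
    ((n : ℝ) + 1)⁻¹ * S.normSq ω a (a - b) ≤ S.dirichlet ω a b := by
  rw [dirichlet_eq]
  refine mul_le_mul_of_nonneg_left ?_ (by positivity)
  have hi := inv_nonneg.2 hV.le
  refine le_trans ?_ (Finset.single_le_sum (fun j hj => ?_)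
    (Finset.mem_range.2 (Nat.succ_pos n) : 0 ∈ Finset.range (n + 1)))
  · refine mul_le_mul_of_nonneg_left ?_ hi
    have hn := NeZero.pos n
    have h1 := wedge_hyb_sub_eq_dform (ω := ω) a b (a - b) ⟨n - 1, by omega⟩
    have h2 := wedge_hyb_antitone ha hb (Nat.zero_le (n - 1)) (by omega)
    rw [S.dform_congr (θ' := fun _ => ω + S.ddc a), S.dform_const_eq _ _ 0] at h1
    · rw [Submodule.coe_sub] at h1
      simp only [Nat.sub_add_cancel hn] at h1
      linarith
    · intro j hj
      have h3 : (j : ℕ) ≠ n - 1 := fun h => hj (Fin.ext h)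
      have h4 : (j : ℕ) < n - 1 := by omega
      simp [hyb, h4]
  · refine mul_nonneg hi (sub_nonneg.2 (wedge_hyb_antitone ha hb ?_ le_rfl))
    exact Nat.lt_succ_iff.1 (Finset.mem_range.1 hj)

lemma dirichlet_nonneg (hV : 0 < S.vol ω) {a b : S.D} (ha : a ∈ S.psh ω) (hb : b ∈ S.psh ω) :
    0 ≤ S.dirichlet ω a b :=
  (mul_nonneg (by positivity) (normSq_nonneg hV ha _)).trans (normSq_le_dirichlet hV ha hb)

lemma normSq_mid_le_dirichlet (hV : 0 < S.vol ω) {a b : S.D} (ha : a ∈ S.psh ω)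
    (hb : b ∈ S.psh ω) :
    S.normSq ω (S.mid a b) (a - b) ≤ 4 * (n + 1) * S.dirichlet ω (S.mid a b) b := by
  have hm := mid_mem_psh ha hb
  have h3 := normSq_le_dirichlet hV hm hb
  have h4 : S.mid a b - b = (2⁻¹ : ℝ) • (a - b) := by
    rw [mid, smul_add, smul_sub]
    nth_rewrite 2 [show b = (2⁻¹ : ℝ) • b + (2⁻¹ : ℝ) • b by rw [← add_smul]; norm_num]
    abel
  rw [h4, normSq_smul, inv_mul_le_iff₀ (by positivity)] at h3
  linarith

lemma normSq_mid_le (hV : 0 < S.vol ω) {a b : S.D} (ha : a ∈ S.psh ω) (hb : b ∈ S.psh ω) :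
    S.normSq ω (S.mid a b) (a - b) ≤ 4 * (n + 1) * S.dirichlet ω a b := by
  have hm := mid_mem_psh ha hb
  refine (normSq_mid_le_dirichlet hV ha hb).trans
    (mul_le_mul_of_nonneg_left ?_ (by positivity))
  rw [S.dirichlet_bregman ω a b]
  linarith [dirichlet_nonneg hV ha hm, dirichlet_nonneg hV hm ha]

lemma MA_sub_eq_sum (a b v : S.D) :
    S.MA ω b (v : C(X, ℝ)) - S.MA ω a (v : C(X, ℝ)) = ∑ k : Fin n, (S.vol ω)⁻¹ *
      S.dform (hyb (ω + S.ddc a) (ω + S.ddc b) k) k v (a - b) := by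
  have := S.wedge_const_sub (ω + S.ddc a) (ω + S.ddc b) (v : C(X, ℝ))
  have h : S.ddc (a - b) = (ω + S.ddc a) - (ω + S.ddc b) := by rw [map_sub]; abel
  rw [MA_apply, MA_apply, ← Finset.mul_sum, ← mul_sub]
  simp_rw [dform_apply, h, Finset.sum_neg_distrib, ← this]
  ring

/-- This is the reason for working at midpoints: one form dominates those of both endpoints. -/
lemma hyb_le_two_smul_mid {a b : S.D} (ha : a ∈ S.psh ω) (hb : b ∈ S.psh ω) (k : ℕ) (i : Fin n) :
    hyb (ω + S.ddc a) (ω + S.ddc b) k i ≤ (2 : ℝ) • (ω + S.ddc (S.mid a b)) := by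
  rw [form_mid, hyb]
  split_ifs
  · exact le_add_of_nonneg_right hb
  · exact le_add_of_nonneg_left ha

/-- Cauchy–Schwarz for differences of Monge–Ampère measures. -/
lemma abs_MA_sub_le (hV : 0 < S.vol ω) {a b : S.D} (ha : a ∈ S.psh ω) (hb : b ∈ S.psh ω)
    (v : S.D) :
    |S.MA ω a (v : C(X, ℝ)) - S.MA ω b (v : C(X, ℝ))| ≤
      n * 2 ^ (n - 1) * (√(S.normSq ω (S.mid a b) v) * √(S.normSq ω (S.mid a b) (a - b))) := by
  have hi := inv_nonneg.2 hV.le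
  -- There are n telescoping terms; in each, domination of the n - 1 free entries by twice the
  -- midpoint form costs 2^(n-1).
  rw [abs_sub_comm, MA_sub_eq_sum]
  refine (Finset.abs_sum_le_sum_abs _ _).trans ?_
  rw [mul_assoc, ← nsmul_eq_mul]
  refine (Finset.sum_le_card_nsmul _ _ _ fun k _ => ?_).trans_eq (by
    rw [Finset.card_univ, Fintype.card_fin])
  have h0 : ∀ j, j ≠ k → 0 ≤ (hyb (ω + S.ddc a) (ω + S.ddc b) k : Fin n → Z) j :=
    fun j _ => hyb_nonneg ha hb _ _
  have h1 := fun u => dform_le_normSq hV h0 (fun j _ => hyb_le_two_smul_mid ha hb k j) u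
  calc _ ≤ _ := abs_inv_vol_mul_dform_le hV h0 v (a - b)
    _ ≤ √(2 ^ (n - 1) * S.normSq ω (S.mid a b) v)
        * √(2 ^ (n - 1) * S.normSq ω (S.mid a b) (a - b)) := by
      exact mul_le_mul (Real.sqrt_le_sqrt (h1 v)) (Real.sqrt_le_sqrt (h1 (a - b)))
        (Real.sqrt_nonneg _) (Real.sqrt_nonneg _)
    _ = _ := by
      have h2 : (0 : ℝ) ≤ 2 ^ (n - 1) := by positivity
      rw [Real.sqrt_mul h2, Real.sqrt_mul h2]
      nth_rewrite 3 [← Real.mul_self_sqrt h2]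
      ring

lemma dirichlet_le_MA_sub (hV : 0 < S.vol ω) {a b : S.D} (ha : a ∈ S.psh ω) (hb : b ∈ S.psh ω) :
    S.dirichlet ω a b ≤ S.MA ω b ((a : C(X, ℝ)) - b) - S.MA ω a ((a : C(X, ℝ)) - b) := by
  rw [← dirichlet_add_dirichlet]
  linarith [dirichlet_nonneg hV hb ha]

lemma dirichlet_le_normSq_mid (hV : 0 < S.vol ω) {a b : S.D} (ha : a ∈ S.psh ω)
    (hb : b ∈ S.psh ω) :
    S.dirichlet ω a b ≤ n * 2 ^ (n - 1) * S.normSq ω (S.mid a b) (a - b) := by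
  have h1 := (abs_le.1 (abs_MA_sub_le hV ha hb (a - b))).1
  rw [Real.mul_self_sqrt (normSq_nonneg hV (mid_mem_psh ha hb) _), Submodule.coe_sub] at h1
  linarith [dirichlet_le_MA_sub hV ha hb]

end Energy

end PluriData

/-! ### Uniform concavity and norm estimates, with constants depending only on n. -/

namespace PluriData

open Function (update)

/-- A constant, depending only on the dimension, absorbing those of the energy estimates. -/
def energyConst (n : ℕ) : ℝ := (n + 1) * 2 ^ (n + 2)

lemma four_mul_le_energyConst (n : ℕ) : 4 * ((n : ℝ) + 1) ≤ energyConst n := by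
  have h : (1 : ℝ) ≤ 2 ^ n := one_le_pow₀ (by norm_num)
  rw [energyConst, pow_add]
  nlinarith [n.cast_nonneg (α := ℝ)]

lemma one_le_energyConst (n : ℕ) : 1 ≤ energyConst n := by
  have := four_mul_le_energyConst n
  have := n.cast_nonneg (α := ℝ)
  linarith

lemma energyConst_pos (n : ℕ) : 0 < energyConst n := zero_lt_one.trans_le (one_le_energyConst n)

lemma two_pow_le_energyConst (n : ℕ) : (2 : ℝ) ^ (n - 1) ≤ energyConst n := by
  have h1 : (2 : ℝ) ^ (n - 1) ≤ 2 ^ (n + 2) := pow_le_pow_right₀ (by norm_num) (by omega)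
  have h2 : (0 : ℝ) ≤ 2 ^ (n + 2) := by positivity
  rw [energyConst]
  nlinarith [n.cast_nonneg (α := ℝ)]

lemma mul_two_pow_le_energyConst (n : ℕ) : (n : ℝ) * 2 ^ (n - 1) ≤ energyConst n := by
  have h1 : (2 : ℝ) ^ (n - 1) ≤ 2 ^ (n + 2) := pow_le_pow_right₀ (by norm_num) (by omega)
  rw [energyConst]
  gcongr
  linarith

variable {X : Type*} [TopologicalSpace X] [CompactSpace X]
  {Z : Type*} [AddCommGroup Z] [Module ℝ Z] [PartialOrder Z] {n : ℕ}
  {S : PluriData X Z n} {ω : Z} [IsOrderedAddMonoid Z] [IsOrderedModule ℝ Z] [NeZero n]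

variable (S ω) in
/-- The squared Dirichlet distance between two potentials. -/
def distSq (a b : S.D) : ℝ := S.normSq ω (S.mid a b) (a - b)

lemma distSq_comm (a b : S.D) : S.distSq ω a b = S.distSq ω b a := by
  rw [distSq, distSq, mid_comm, ← neg_sub, normSq_neg]

lemma distSq_nonneg (hV : 0 < S.vol ω) {a b : S.D} (ha : a ∈ S.psh ω) (hb : b ∈ S.psh ω) :
    0 ≤ S.distSq ω a b := normSq_nonneg hV (mid_mem_psh ha hb) _

lemma distSq_le_dirichlet (hV : 0 < S.vol ω) {a b : S.D} (ha : a ∈ S.psh ω) (hb : b ∈ S.psh ω) :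
    S.distSq ω a b ≤ energyConst n * S.dirichlet ω a b :=
  (normSq_mid_le hV ha hb).trans
    (mul_le_mul_of_nonneg_right (four_mul_le_energyConst n) (dirichlet_nonneg hV ha hb))

lemma dirichlet_le_distSq (hV : 0 < S.vol ω) {a b : S.D} (ha : a ∈ S.psh ω) (hb : b ∈ S.psh ω) :
    S.dirichlet ω a b ≤ energyConst n * S.distSq ω a b :=
  (dirichlet_le_normSq_mid hV ha hb).trans
    (mul_le_mul_of_nonneg_right (mul_two_pow_le_energyConst n) (distSq_nonneg hV ha hb))

lemma dirichlet_comm_le (hV : 0 < S.vol ω) {a b : S.D} (ha : a ∈ S.psh ω) (hb : b ∈ S.psh ω) :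
    S.dirichlet ω b a ≤ energyConst n ^ 2 * S.dirichlet ω a b := by
  have h1 := dirichlet_le_distSq hV hb ha
  rw [distSq_comm] at h1
  refine h1.trans ?_
  rw [sq, mul_assoc]
  exact mul_le_mul_of_nonneg_left (distSq_le_dirichlet hV ha hb) (energyConst_pos n).le

/-- Uniform concavity of the Monge–Ampère energy. -/
lemma distSq_le_energy_mid (hV : 0 < S.vol ω) {a b : S.D} (ha : a ∈ S.psh ω) (hb : b ∈ S.psh ω) :
    S.distSq ω a b ≤ energyConst n * (2 * S.mongeAmpereEnergy ω (S.mid a b)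
      - S.mongeAmpereEnergy ω a - S.mongeAmpereEnergy ω b) := by
  have hm := mid_mem_psh ha hb
  rw [two_mul_energy_mid]
  refine (normSq_mid_le_dirichlet hV ha hb).trans (mul_le_mul (four_mul_le_energyConst n) ?_
    (dirichlet_nonneg hV hm hb) (energyConst_pos n).le)
  linarith [dirichlet_nonneg hV hm ha]

lemma energy_mid_nonneg (hV : 0 < S.vol ω) {a b : S.D} (ha : a ∈ S.psh ω) (hb : b ∈ S.psh ω) :
    0 ≤ 2 * S.mongeAmpereEnergy ω (S.mid a b)
      - S.mongeAmpereEnergy ω a - S.mongeAmpereEnergy ω b := by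
  rw [two_mul_energy_mid]
  exact add_nonneg (dirichlet_nonneg hV (mid_mem_psh ha hb) ha)
    (dirichlet_nonneg hV (mid_mem_psh ha hb) hb)

/-- J(p, ·) is -E plus an affine function, so its convexity defect does not depend on `p`. -/
lemma dirichlet_sub_mid (p a b : S.D) :
    S.dirichlet ω p a + S.dirichlet ω p b - 2 * S.dirichlet ω p (S.mid a b)
      = 2 * S.mongeAmpereEnergy ω (S.mid a b)
      - S.mongeAmpereEnergy ω a - S.mongeAmpereEnergy ω b := by
  simp only [dirichlet, coe_mid, map_sub, map_smul, map_add, smul_eq_mul]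
  ring

/-- Uniform convexity of J(p, ·), together with J ≥ 0 at the midpoint, yields the quasi-triangle
inequality. -/
lemma distSq_le_add (hV : 0 < S.vol ω) {p a b : S.D} (hp : p ∈ S.psh ω) (ha : a ∈ S.psh ω)
    (hb : b ∈ S.psh ω) :
    S.distSq ω a b ≤ energyConst n * (S.dirichlet ω p a + S.dirichlet ω p b) := by
  refine (distSq_le_energy_mid hV ha hb).trans
    (mul_le_mul_of_nonneg_left ?_ (energyConst_pos n).le)
  rw [← dirichlet_sub_mid p]
  linarith [dirichlet_nonneg hV hp (mid_mem_psh ha hb)]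

lemma potentialEnergy_zero : S.potentialEnergy ω 0 = 0 := dirichlet_self S ω 0

lemma potentialEnergy_nonneg (hV : 0 < S.vol ω) (hω : 0 ≤ ω) {a : S.D} (ha : a ∈ S.psh ω) :
    0 ≤ S.potentialEnergy ω a := dirichlet_nonneg hV (zero_mem_psh hω) ha

lemma potentialEnergy_mid_le (hV : 0 < S.vol ω) {a b : S.D} (ha : a ∈ S.psh ω)
    (hb : b ∈ S.psh ω) : S.potentialEnergy ω (S.mid a b)
      ≤ (S.potentialEnergy ω a + S.potentialEnergy ω b) / 2 := by
  have := dirichlet_sub_mid (ω := ω) 0 a b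
  simp only [potentialEnergy]
  linarith [energy_mid_nonneg hV ha hb]

/-- Take a = σ/2 and b = (σ + φ)/2. Then b - a = φ/2, and twice the form of their midpoint dominates
the form of σ. The norm of φ there is bounded by the concavity defect of E between a and b, hence by
J(a) + J(b), and J is convex. -/
lemma normSq_le_potentialEnergy (hV : 0 < S.vol ω) (hω : 0 ≤ ω) {σ φ : S.D} (hσ : σ ∈ S.psh ω)
    (hφ : φ ∈ S.psh ω) : S.normSq ω σ φ ≤
      energyConst n * (S.potentialEnergy ω φ + S.potentialEnergy ω σ) := by
  have h0 : (0 : S.D) ∈ S.psh ω := zero_mem_psh hω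
  set a := S.mid σ 0 with ha'
  set b := S.mid σ φ with hb'
  have ha : a ∈ S.psh ω := mid_mem_psh hσ h0
  have hb : b ∈ S.psh ω := mid_mem_psh hσ hφ
  have hm : S.mid a b ∈ S.psh ω := mid_mem_psh ha hb
  have e1 : b - a = (2⁻¹ : ℝ) • φ := by
    rw [ha', hb', mid, mid]; module
  have h1 : ω + S.ddc σ ≤ (2 : ℝ) • (ω + S.ddc (S.mid a b)) := by
    rw [form_mid]
    have h2 : (ω + S.ddc a) + (ω + S.ddc b) = (ω + S.ddc σ) + (ω + S.ddc (S.mid 0 φ)) := by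
      simp only [ha', hb', mid, map_add, map_smul, add_zero, zero_add]
      module
    rw [h2]
    exact le_add_of_nonneg_right (mid_mem_psh h0 hφ)
  have h2 := normSq_mid_le_dirichlet hV ha hb
  have h3 := normSq_mid_le_dirichlet hV hb ha
  have h4 := two_mul_energy_mid S ω a b
  have h5 := dirichlet_sub_mid (ω := ω) 0 a b
  have h6 := potentialEnergy_mid_le hV hσ h0
  have h7 := potentialEnergy_mid_le hV hσ hφ
  have h8 := dirichlet_nonneg hV h0 hm
  have h9 := normSq_le_normSq hV hσ h1 φ
  rw [potentialEnergy_zero] at h6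
  rw [← normSq_neg, neg_sub, e1, normSq_smul] at h2
  rw [mid_comm, e1, normSq_smul] at h3
  simp only [potentialEnergy] at h6 h7 ⊢
  rw [← ha'] at h6
  rw [← hb'] at h7
  have hn : (0 : ℝ) ≤ 4 * (n + 1) := by positivity
  have hpos := potentialEnergy_nonneg hV hω hφ
  rw [potentialEnergy] at hpos
  have h10 : S.normSq ω (S.mid a b) φ ≤ 4 * (n + 1) * 2 *
      (S.dirichlet ω 0 φ + S.dirichlet ω 0 σ) := by
    have : S.dirichlet ω (S.mid a b) a + S.dirichlet ω (S.mid a b) b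
      ≤ S.dirichlet ω 0 φ + S.dirichlet ω 0 σ := by linarith
    have := mul_le_mul_of_nonneg_left this hn
    linarith
  calc S.normSq ω σ φ ≤ 2 ^ (n - 1) * S.normSq ω (S.mid a b) φ := h9
    _ ≤ 2 ^ (n - 1) * (4 * (n + 1) * 2 * (S.dirichlet ω 0 φ + S.dirichlet ω 0 σ)) := by gcongr
    _ = _ := by
      -- The factors multiply to exactly `energyConst n`: 2^(n-1) · 8 (n+1) = (n+1) 2^(n+2).
      rw [energyConst, show n + 2 = (n - 1) + 3 by have := NeZero.pos n; omega, pow_add]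
      ring

/-- J(tφ) is comparable to t² times a norm of φ relative to the form of tφ/2, which is at most twice
the form of φ/2. The quadratic decay allows normalizing a test function to energy at most 1. -/
lemma potentialEnergy_smul_le (hV : 0 < S.vol ω) (hω : 0 ≤ ω) {φ : S.D} (hφ : φ ∈ S.psh ω) {t : ℝ}
    (ht : 0 ≤ t) (ht1 : t ≤ 1) :
    S.potentialEnergy ω (t • φ) ≤ energyConst n ^ 3 * (t ^ 2 * S.potentialEnergy ω φ) := by
  have h0 : (0 : S.D) ∈ S.psh ω := zero_mem_psh hω
  have htφ := smul_mem_psh hω hφ ht ht1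
  have h1 := dirichlet_le_distSq hV h0 htφ
  have h2 := distSq_le_dirichlet hV h0 hφ
  have h3 : ω + S.ddc (S.mid 0 (t • φ)) ≤ (2 : ℝ) • (ω + S.ddc (S.mid 0 φ)) := by
    rw [form_mid]
    rw [← sub_nonneg]
    have h4 : (ω + S.ddc 0) + (ω + S.ddc φ) - (ω + S.ddc (S.mid 0 (t • φ)))
        = (1 - (2⁻¹ : ℝ) * t) • (ω + S.ddc φ) + ((2⁻¹ : ℝ) * t) • ω := by
      simp only [mid, zero_add, map_zero, add_zero, map_smul, smul_smul]
      module
    rw [h4]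
    exact add_nonneg (smul_nonneg (by linarith) hφ) (smul_nonneg (by linarith) hω)
  have h4 := normSq_le_normSq hV (mid_mem_psh h0 htφ) h3 φ
  rw [distSq, zero_sub, normSq_neg] at h1 h2
  rw [normSq_smul] at h1
  have hc := energyConst_pos n
  have hφ0 := potentialEnergy_nonneg hV hω hφ
  calc S.potentialEnergy ω (t • φ) ≤ energyConst n * (t ^ 2 * S.normSq ω (S.mid 0 (t • φ)) φ) := h1
    _ ≤ energyConst n * (t ^ 2 * (2 ^ (n - 1) * S.normSq ω (S.mid 0 φ) φ)) := by gcongr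
    _ ≤ energyConst n * (t ^ 2 * (energyConst n * (energyConst n * S.potentialEnergy ω φ))) := by
      gcongr
      · exact normSq_nonneg hV (mid_mem_psh h0 hφ) _
      · exact two_pow_le_energyConst n
      · exact h2
    _ = _ := by ring

lemma abs_MA_sub_le_distSq (hV : 0 < S.vol ω) {a b : S.D} (ha : a ∈ S.psh ω) (hb : b ∈ S.psh ω)
    (v : S.D) : |S.MA ω a (v : C(X, ℝ)) - S.MA ω b (v : C(X, ℝ))| ≤
      energyConst n * (√(S.normSq ω (S.mid a b) v) * √(S.distSq ω a b)) :=
  (abs_MA_sub_le hV ha hb v).trans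
    (mul_le_mul_of_nonneg_right (mul_two_pow_le_energyConst n) (by positivity))

/-- In the Cauchy–Schwarz bound, the norm of φ relative to the midpoint is controlled by energies
through `normSq_le_potentialEnergy`. -/
lemma abs_MA_sub_psh_le (hV : 0 < S.vol ω) (hω : 0 ≤ ω) {a b φ : S.D} (ha : a ∈ S.psh ω)
    (hb : b ∈ S.psh ω) (hφ : φ ∈ S.psh ω) :
    |S.MA ω a (φ : C(X, ℝ)) - S.MA ω b (φ : C(X, ℝ))| ≤
      energyConst n ^ 2 * (√(S.potentialEnergy ω φ + S.potentialEnergy ω a + S.potentialEnergy ω b)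
        * √(S.distSq ω a b)) := by
  have hc := one_le_energyConst n
  have h1 := normSq_le_potentialEnergy hV hω (mid_mem_psh ha hb) hφ
  have h2 := potentialEnergy_mid_le hV ha hb
  have ha0 := potentialEnergy_nonneg hV hω ha
  have hb0 := potentialEnergy_nonneg hV hω hb
  have hφ0 := potentialEnergy_nonneg hV hω hφ
  set T := S.potentialEnergy ω φ + S.potentialEnergy ω a + S.potentialEnergy ω b with hT
  have hT0 : 0 ≤ T := by positivity
  have h3 : √(S.normSq ω (S.mid a b) φ) ≤ energyConst n * √T := by
    rw [Real.sqrt_le_left (by positivity), mul_pow, Real.sq_sqrt hT0]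
    refine h1.trans (mul_le_mul ?_ (by linarith) (by
      linarith [potentialEnergy_nonneg hV hω (mid_mem_psh ha hb)]) (by positivity))
    nlinarith
  calc _ ≤ energyConst n * (√(S.normSq ω (S.mid a b) φ) * √(S.distSq ω a b)) :=
        abs_MA_sub_le_distSq hV ha hb φ
    _ ≤ energyConst n * ((energyConst n * √T) * √(S.distSq ω a b)) := by gcongr
    _ = _ := by ring

lemma wedge_exchange (S : PluriData X Z n) (θ : Fin n → Z) {i j : Fin n} (hij : i ≠ j) (a b : Z)
    (f : C(X, ℝ)) :
    S.wedge (update (update θ i a) j b) f = S.wedge (update (update θ i b) j a) f := by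
  rw [← S.wedge_swap _ i j]
  congr 2
  ext k
  by_cases hkj : k = j
  · subst hkj; simp [hij]
  · by_cases hki : k = i
    · subst hki; simp [hij]
    · rw [Equiv.swap_apply_of_ne_of_ne hki hkj]; simp [hki, hkj]

/-- Modulus of continuity for exchanging one form. -/
def exchangeModulus (n : ℕ) (M x : ℝ) : ℝ := x + 2 * √(2 * x * (4 ^ (n - 1) * M))

lemma exchangeModulus_mono (n : ℕ) {M : ℝ} (hM : 0 ≤ M) : Monotone (exchangeModulus n M) := by
  intro x y hxy
  unfold exchangeModulus
  gcongr

lemma continuous_exchangeModulus (n : ℕ) (M : ℝ) : Continuous (exchangeModulus n M) := by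
  unfold exchangeModulus
  fun_prop

lemma le_exchangeModulus (n : ℕ) (M x : ℝ) : x ≤ exchangeModulus n M x :=
  le_add_of_nonneg_right (by positivity)

lemma exchangeModulus_zero (n : ℕ) (M : ℝ) : exchangeModulus n M 0 = 0 := by
  simp [exchangeModulus]

/-- The Dirichlet norm of `ψ - ψ'` with respect to any form of bounded energy is controlled by the
Dirichlet distance of `ψ` and `ψ'`. -/
lemma normSq_sub_le_iterate (hV : 0 < S.vol ω) {σ ψ ψ' : S.D} (hσ : σ ∈ S.psh ω)
    (hψ : ψ ∈ S.psh ω) (hψ' : ψ' ∈ S.psh ω) :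
    S.normSq ω σ (ψ - ψ') ≤
      (exchangeModulus n (S.distSq ω σ (S.mid ψ ψ')))^[n] (S.distSq ω ψ ψ') := by
  set χ := S.mid ψ ψ' with hχ
  have hχm : χ ∈ S.psh ω := mid_mem_psh hψ hψ'
  set M := S.distSq ω σ χ
  have hM : 0 ≤ M := distSq_nonneg hV hσ hχm
  set τ := S.mid σ χ with hτ
  set u := ψ - ψ' with hu
  set w := σ - χ with hw
  have hi := inv_nonneg.2 hV.le
  have h2χ : ∀ {a : S.D}, a = ψ ∨ a = ψ' → ω + S.ddc a ≤ (2 : ℝ) • (ω + S.ddc χ) := by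
    rintro a (rfl | rfl)
    · rw [hχ, form_mid]; exact le_add_of_nonneg_right hψ'
    · rw [hχ, form_mid]; exact le_add_of_nonneg_left hψ
  have h2τ : ω + S.ddc χ ≤ (2 : ℝ) • (ω + S.ddc τ) := by
    rw [hτ, form_mid]; exact le_add_of_nonneg_left hσ
  have h2σ : ω + S.ddc σ ≤ (2 : ℝ) • (ω + S.ddc τ) := by
    rw [hτ, form_mid]; exact le_add_of_nonneg_right hχm
  have h24 : (2 : ℝ) • (ω + S.ddc τ) ≤ (4 : ℝ) • (ω + S.ddc τ) :=
    smul_le_smul_of_nonneg_right (by norm_num) (mid_mem_psh hσ hχm)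
  have h4 : ∀ {a : S.D}, a = ψ ∨ a = ψ' → ω + S.ddc a ≤ (4 : ℝ) • (ω + S.ddc τ) := by
    intro a ha
    refine (h2χ ha).trans ((smul_le_smul_of_nonneg_left h2τ (by norm_num)).trans_eq ?_)
    rw [smul_smul]; norm_num
  -- These families interpolate between the forms of χ, for which the norm of `u` is the given
  -- distance, and those of σ. Each entry moved from χ to σ costs one application of the modulus.
  set θ : Finset (Fin n) → Fin n → Z :=
    fun s => s.piecewise (fun _ => ω + S.ddc σ) (fun _ => ω + S.ddc χ) with hθ
  have hθ0 : ∀ s i, 0 ≤ θ s i := by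
    intro s i
    by_cases hs : i ∈ s
    · simp only [hθ, Finset.piecewise_eq_of_mem _ _ _ hs]
      exact hσ
    · simp only [hθ, Finset.piecewise_eq_of_notMem _ _ _ hs]
      exact hχm
  have hθ4 : ∀ s i, θ s i ≤ (4 : ℝ) • (ω + S.ddc τ) := by
    intro s i
    by_cases hs : i ∈ s
    · simpa [hθ, hs] using h2σ.trans h24
    · simpa [hθ, hs] using h2τ.trans h24
  suffices H : ∀ s : Finset (Fin n), (S.vol ω)⁻¹ * S.dform (θ s) 0 u u
      ≤ (exchangeModulus n M)^[s.card] (S.distSq ω ψ ψ') by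
    simpa [hθ, normSq] using H Finset.univ
  intro s
  induction s using Finset.induction_on with
  | empty => simp [hθ, distSq, normSq, hχ, hu]
  | insert j s hj ih =>
    rw [Finset.card_insert_of_notMem hj, Function.iterate_succ_apply']
    refine le_trans ?_ (exchangeModulus_mono n hM ih)
    set x := (S.vol ω)⁻¹ * S.dform (θ s) 0 u u with hx
    have hθj : θ (insert j s) = update (θ s) j (ω + S.ddc σ) := by
      simp only [hθ]; rw [Finset.piecewise_insert]
    have hθs : update (θ s) j (ω + S.ddc χ) = θ s := by
      simp [hθ, hj]
    rw [hθj]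
    by_cases hj0 : j = 0
    · subst hj0
      rw [dform_update]
      exact le_exchangeModulus n M x
    -- exchange the entries of index `0` and `j`
    have key : S.dform (update (θ s) j (ω + S.ddc σ)) 0 u u
        = S.dform (θ s) 0 u u + (S.dform (update (θ s) j (ω + S.ddc ψ)) 0 u w
          - S.dform (update (θ s) j (ω + S.ddc ψ')) 0 u w) := by
      have e1 : S.dform (θ s) 0 u u = S.dform (update (θ s) j (ω + S.ddc χ)) 0 u u := by rw [hθs]
      have e2 : S.ddc w = (ω + S.ddc σ) - (ω + S.ddc χ) := by rw [hw, map_sub]; abel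
      have e3 : S.ddc u = (ω + S.ddc ψ) - (ω + S.ddc ψ') := by rw [hu, map_sub]; abel
      have e4 : S.wedge (update (update (θ s) 0 (S.ddc u)) j (S.ddc w)) (u : C(X, ℝ))
          = S.wedge (update (update (θ s) 0 (S.ddc w)) j (S.ddc u)) (u : C(X, ℝ)) := S.wedge_exchange _ (Ne.symm hj0) _ _ _
      rw [e1]
      simp only [dform_apply]
      rw [Function.update_comm hj0, Function.update_comm hj0, Function.update_comm hj0,
        Function.update_comm hj0]
      have e5 := S.wedge_update_sub (update (θ s) 0 (S.ddc u)) j (ω + S.ddc σ) (ω + S.ddc χ)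
        (u : C(X, ℝ))
      have e6 := S.wedge_update_sub (update (θ s) 0 (S.ddc w)) j (ω + S.ddc ψ) (ω + S.ddc ψ')
        (u : C(X, ℝ))
      rw [← e2] at e5
      rw [← e3] at e6
      linarith
    -- In Cauchy–Schwarz, the norm of `u` is at most 2x, since the form of `a` is at most twice that
    -- of χ, which fills slot `j` in `θ s`. The norm of `w` is at most 4^(n-1) M, since all entries
    -- are at most 4 times the form of τ.
    have hCS : ∀ {a : S.D}, a = ψ ∨ a = ψ' →
        |(S.vol ω)⁻¹ * S.dform (update (θ s) j (ω + S.ddc a)) 0 u w|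
          ≤ √(2 * x * (4 ^ (n - 1) * M)) := by
      intro a ha
      have ham : 0 ≤ ω + S.ddc a := by rcases ha with rfl | rfl; exacts [hψ, hψ']
      have hθa0 : ∀ i, i ≠ 0 → 0 ≤ update (θ s) j (ω + S.ddc a) i := fun i _ => by
        by_cases hij : i = j
        · subst hij; simpa using ham
        · rw [Function.update_of_ne hij]; exact hθ0 s i
      have hθa4 : ∀ i, i ≠ 0 → update (θ s) j (ω + S.ddc a) i ≤ (4 : ℝ) • (ω + S.ddc τ) :=
        fun i _ => by
        by_cases hij : i = j
        · subst hij; simpa using h4 ha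
        · rw [Function.update_of_ne hij]; exact hθ4 s i
      refine (abs_inv_vol_mul_dform_le hV hθa0 u w).trans ?_
      rw [← Real.sqrt_mul (mul_nonneg hi (S.dform_self_nonneg hθa0 u))]
      refine Real.sqrt_le_sqrt (mul_le_mul ?_ (dform_le_normSq hV hθa0 hθa4 w)
        (mul_nonneg hi (S.dform_self_nonneg hθa0 w)) (mul_nonneg zero_le_two
          (mul_nonneg hi (S.dform_self_nonneg (fun i _ => hθ0 s i) u))))
      have h7 := S.dform_mono (θ' := update (θ s) j ((2 : ℝ) • (ω + S.ddc χ))) hθa0 (fun i _ => by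
        by_cases hij : i = j
        · subst hij; simpa using h2χ ha
        · rw [Function.update_of_ne hij, Function.update_of_ne hij]) u
      rw [dform_apply _ (update _ _ ((2 : ℝ) • _)), Function.update_comm hj0, wedge_update_smul,
        Function.update_comm (Ne.symm hj0), hθs, ← mul_neg, ← dform_apply] at h7
      calc _ ≤ (S.vol ω)⁻¹ * _ := mul_le_mul_of_nonneg_left h7 hi
        _ = _ := by rw [hx]; ring
    have h5 := abs_le.1 (hCS (Or.inl rfl))
    have h6 := abs_le.1 (hCS (Or.inr rfl))
    rw [key, exchangeModulus, mul_add, mul_sub, ← hx]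
    linarith [h5.2, h6.1]

end PluriData

/-! ### Measures of finite energy and their maximizing potentials. -/

namespace PluriData

variable {X : Type*} [TopologicalSpace X] [CompactSpace X]
  {Z : Type*} [AddCommGroup Z] [Module ℝ Z] [PartialOrder Z] {n : ℕ}
  {S : PluriData X Z n} {ω : Z} [IsOrderedAddMonoid Z] [IsOrderedModule ℝ Z] [NeZero n]

variable (S ω) in
/-- The standing assumptions on the form `ω`. -/
structure IsAdmissible : Prop where
  nonneg : 0 ≤ ω
  mem_posCone : (LinearMap.range S.ddc).mkQ ω ∈ S.posCone
  orthogonality : S.Orthogonality ω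

lemma IsAdmissible.vol_pos (h : S.IsAdmissible ω) : 0 < S.vol ω := S.vol_pos h.mem_posCone

lemma IsAdmissible.MA_isProbability (h : S.IsAdmissible ω) {φ : S.D} (hφ : φ ∈ S.psh ω) :
    (S.MA ω φ).IsProbability := by
  constructor
  · intro f hf
    exact mul_nonneg (inv_nonneg.2 h.vol_pos.le) (S.wedge_pos _ (fun _ => hφ) f hf)
  · rw [MA_apply, S.wedge_add_ddc_one (fun _ => ω) fun _ => φ]
    exact inv_mul_cancel₀ h.vol_pos.ne'

namespace FiniteEnergyMeasure

@[ext]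
lemma ext {μ ν : S.FiniteEnergyMeasure ω} (h : μ.toRadon = ν.toRadon) : μ = ν := by
  cases μ; cases ν; simpa using h

/-- The real number `J_ω(μ, ψ)`. -/
def relJ (μ : S.FiniteEnergyMeasure ω) (ψ : S.D) : ℝ :=
  μ.J - S.mongeAmpereEnergy ω ψ + μ.toRadon (ψ : C(X, ℝ))

lemma coe_J (h : S.IsAdmissible ω) (μ : S.FiniteEnergyMeasure ω) :
    (μ.J : EReal) = S.energy ω μ.toRadon := by
  refine EReal.coe_toReal μ.energy_lt_top.ne ?_
  have : (0 : EReal) ≤ S.energy ω μ.toRadon := by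
    refine le_trans (le_of_eq ?_) (le_iSup _ ⟨0, zero_mem_psh h.nonneg⟩)
    simp
  exact (lt_of_lt_of_le (by simp) this).ne'

lemma energy_sub_le_J (h : S.IsAdmissible ω) (μ : S.FiniteEnergyMeasure ω) {φ : S.D}
    (hφ : φ ∈ S.psh ω) : S.mongeAmpereEnergy ω φ - μ.toRadon (φ : C(X, ℝ)) ≤ μ.J := by
  have h1 : ((S.mongeAmpereEnergy ω φ - μ.toRadon (φ : C(X, ℝ)) : ℝ) : EReal) ≤ μ.J := by
    rw [coe_J h]
    refine le_trans (le_of_eq ?_) (le_iSup _ ⟨φ, hφ⟩)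
    simp [mongeAmpereEnergy_zero, sub_eq_add_neg]
  exact_mod_cast h1

lemma exists_lt_energy_sub (h : S.IsAdmissible ω) (μ : S.FiniteEnergyMeasure ω) {c : ℝ}
    (hc : c < μ.J) : ∃ φ ∈ S.psh ω, c < S.mongeAmpereEnergy ω φ - μ.toRadon (φ : C(X, ℝ)) := by
  have h1 : (c : EReal) < S.energy ω μ.toRadon := by rw [← coe_J h]; exact_mod_cast hc
  obtain ⟨⟨φ, hφ⟩, h2⟩ := lt_iSup_iff.1 h1
  refine ⟨φ, hφ, ?_⟩
  have h3 := EReal.coe_lt_coe_iff.1 h2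
  simpa [mongeAmpereEnergy_zero, sub_eq_add_neg] using h3

lemma relJ_zero (μ : S.FiniteEnergyMeasure ω) : μ.relJ 0 = μ.J := by
  simp [relJ, mongeAmpereEnergy_zero]

lemma relJ_nonneg (h : S.IsAdmissible ω) (μ : S.FiniteEnergyMeasure ω) {φ : S.D}
    (hφ : φ ∈ S.psh ω) : 0 ≤ μ.relJ φ := by
  have := μ.energy_sub_le_J h hφ
  rw [relJ]; linarith

lemma J_nonneg (h : S.IsAdmissible ω) (μ : S.FiniteEnergyMeasure ω) : 0 ≤ μ.J := by
  rw [← relJ_zero]; exact μ.relJ_nonneg h (zero_mem_psh h.nonneg)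

lemma exists_relJ_lt (h : S.IsAdmissible ω) (μ : S.FiniteEnergyMeasure ω) {ε : ℝ} (hε : 0 < ε) :
    ∃ φ ∈ S.psh ω, μ.relJ φ < ε := by
  obtain ⟨φ, hφ, h1⟩ := μ.exists_lt_energy_sub h (show μ.J - ε < μ.J by linarith)
  exact ⟨φ, hφ, by rw [relJ]; linarith⟩

lemma relEnergy_eq (h : S.IsAdmissible ω) (μ : S.FiniteEnergyMeasure ω) (ψ : S.D) :
    S.relEnergy ω μ.toRadon ψ = (μ.relJ ψ : EReal) := by
  apply le_antisymm
  · refine iSup_le fun φ => EReal.coe_le_coe_iff.2 ?_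
    have := μ.energy_sub_le_J h φ.2
    rw [map_sub, relJ]; linarith
  · refine EReal.ge_of_forall_gt_iff_ge.1 fun c hc => ?_
    have hc' : c < μ.relJ ψ := by exact_mod_cast hc
    obtain ⟨φ, hφ, h1⟩ := μ.exists_lt_energy_sub h
      (show c + S.mongeAmpereEnergy ω ψ - μ.toRadon (ψ : C(X, ℝ)) < μ.J by
        rw [relJ] at hc'; linarith)
    refine le_trans ?_ (le_iSup _ ⟨φ, hφ⟩)
    refine EReal.coe_le_coe_iff.2 ?_
    rw [map_sub]; simp only; linarith

/-- The filter of maximizing potentials of a measure of finite energy. -/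
def maximizing (μ : S.FiniteEnergyMeasure ω) : Filter (S.psh ω) :=
  comap (fun ψ => μ.relJ ψ) (𝓝 0)

lemma tendsto_relJ_maximizing (μ : S.FiniteEnergyMeasure ω) :
    Tendsto (fun ψ : S.psh ω => μ.relJ ψ) μ.maximizing (𝓝 0) := tendsto_comap

lemma eventually_maximizing_lt (μ : S.FiniteEnergyMeasure ω) {ε : ℝ} (hε : 0 < ε) :
    ∀ᶠ ψ : S.psh ω in μ.maximizing, μ.relJ ψ < ε :=
  μ.tendsto_relJ_maximizing.eventually_lt_const hε

lemma maximizing_neBot (h : S.IsAdmissible ω) (μ : S.FiniteEnergyMeasure ω) :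
    μ.maximizing.NeBot := by
  refine comap_neBot fun t ht => ?_
  obtain ⟨ε, hε, hb⟩ := Metric.mem_nhds_iff.1 ht
  obtain ⟨φ, hφ, h1⟩ := μ.exists_relJ_lt h hε
  refine ⟨⟨φ, hφ⟩, hb ?_⟩
  rw [Metric.mem_ball, Real.dist_eq, sub_zero, abs_of_nonneg (μ.relJ_nonneg h hφ)]
  exact h1

lemma dirichletQM_eq_limUnder (h : S.IsAdmissible ω) (μ ν : S.FiniteEnergyMeasure ω) :
    S.dirichletQM ω μ ν = limUnder ν.maximizing (fun ψ : S.psh ω => μ.relJ ψ) := by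
  have h1 : comap (fun ψ : S.psh ω => S.relEnergy ω ν.toRadon ψ) (𝓝 0) = ν.maximizing := by
    simp_rw [relEnergy_eq h]
    rw [maximizing, ← EReal.coe_zero, EReal.isEmbedding_coe.nhds_eq_comap, comap_comap]
    rfl
  rw [dirichletQM, h1]
  simp_rw [relEnergy_eq h, EReal.toReal_coe]

lemma relJ_sub_mid (μ : S.FiniteEnergyMeasure ω) (a b : S.D) :
    μ.relJ a + μ.relJ b - 2 * μ.relJ (S.mid a b) = 2 * S.mongeAmpereEnergy ω (S.mid a b)
      - S.mongeAmpereEnergy ω a - S.mongeAmpereEnergy ω b := by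
  simp only [relJ, coe_mid, map_smul, map_add, smul_eq_mul]
  ring

/-- J(μ, ·) is -E plus an affine function, so uniform concavity of E applies. In particular,
maximizing potentials of μ are mutually close. -/
lemma distSq_le (h : S.IsAdmissible ω) (μ : S.FiniteEnergyMeasure ω) {a b : S.D}
    (ha : a ∈ S.psh ω) (hb : b ∈ S.psh ω) :
    S.distSq ω a b ≤ energyConst n * (μ.relJ a + μ.relJ b) := by
  refine (distSq_le_energy_mid h.vol_pos ha hb).trans
    (mul_le_mul_of_nonneg_left ?_ (energyConst_pos n).le)
  rw [← μ.relJ_sub_mid]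
  linarith [μ.relJ_nonneg h (mid_mem_psh ha hb)]

lemma potentialEnergy_le (h : S.IsAdmissible ω) (μ : S.FiniteEnergyMeasure ω) {a : S.D}
    (ha : a ∈ S.psh ω) : S.potentialEnergy ω a ≤ energyConst n ^ 2 * (μ.J + μ.relJ a) := by
  have h0 := zero_mem_psh (S := S) h.nonneg
  have h1 := μ.distSq_le h h0 ha
  rw [relJ_zero] at h1
  calc S.potentialEnergy ω a ≤ energyConst n * S.distSq ω 0 a := dirichlet_le_distSq h.vol_pos h0 ha
    _ ≤ energyConst n * (energyConst n * (μ.J + μ.relJ a)) :=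
      mul_le_mul_of_nonneg_left h1 (energyConst_pos n).le
    _ = _ := by ring

end FiniteEnergyMeasure

/-- Nonnegativity of J(φ, ·) says exactly that the supremum is attained at φ. -/
lemma relEnergy_MA (h : S.IsAdmissible ω) {φ : S.D} (hφ : φ ∈ S.psh ω) (ψ : S.D) :
    S.relEnergy ω (S.MA ω φ) ψ = (S.dirichlet ω φ ψ : EReal) := by
  apply le_antisymm
  · refine iSup_le fun χ => EReal.coe_le_coe_iff.2 ?_
    have := dirichlet_nonneg h.vol_pos hφ χ.2
    simp only [dirichlet, map_sub] at this ⊢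
    linarith
  · exact le_iSup (fun χ : S.psh ω => ((S.mongeAmpereEnergy ω (χ : S.D) - S.mongeAmpereEnergy ω ψ
      + S.MA ω φ ((ψ : C(X, ℝ)) - ((χ : S.D) : C(X, ℝ))) : ℝ) : EReal)) ⟨φ, hφ⟩

/-- The Monge–Ampère measure of a potential, as a measure of finite energy. -/
def IsAdmissible.toMeasure (h : S.IsAdmissible ω) (φ : S.psh ω) : S.FiniteEnergyMeasure ω where
  toRadon := S.MA ω φ
  isProbability := h.MA_isProbability φ.2
  energy_lt_top := by
    rw [energy, relEnergy_MA h φ.2]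
    exact EReal.coe_lt_top _

lemma IsAdmissible.relJ_toMeasure (h : S.IsAdmissible ω) (φ : S.psh ω) (ψ : S.D) :
    (h.toMeasure φ).relJ ψ = S.dirichlet ω φ ψ :=
  EReal.coe_injective (((h.toMeasure φ).relEnergy_eq h ψ).symm.trans (relEnergy_MA h φ.2 ψ))

lemma IsAdmissible.J_toMeasure (h : S.IsAdmissible ω) (φ : S.psh ω) :
    (h.toMeasure φ).J = S.dirichlet ω φ 0 := by
  rw [← FiniteEnergyMeasure.relJ_zero, h.relJ_toMeasure]

/-! ### Orthogonality: Monge–Ampère measures of maximizing potentials converge to the measure. -/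

namespace FiniteEnergyMeasure

/-- Perturbing a potential in the direction of a test function. -/
lemma exists_MA_le (h : S.IsAdmissible ω) (μ : S.FiniteEnergyMeasure ω) {ψ : S.D}
    (hψ : ψ ∈ S.psh ω) (f : S.D) {t : ℝ} (ht : 0 < t) :
    ∃ φ ∈ S.psh ω, S.MA ω φ (f : C(X, ℝ)) ≤ μ.toRadon (f : C(X, ℝ)) + μ.relJ ψ / t + t ∧
      S.dirichlet ω φ ψ ≤ 2 * t * ‖(f : C(X, ℝ))‖ + t ^ 2 := by
  -- φ nearly solves the obstacle problem below ψ + t f. The contact error t² is still O(t) after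
  -- the later division by t.
  obtain ⟨φ, hφ, hlt, hle⟩ := h.orthogonality.2 (ψ + t • f) (t ^ 2) (by positivity)
  have h1 := hle φ hφ (fun _ => le_rfl) hlt
  have hle' : (φ : C(X, ℝ)) ≤ (ψ : C(X, ℝ)) + t • (f : C(X, ℝ)) := fun x => (hlt x).le
  have h2 := μ.isProbability.1.mono hle'
  have h3 := μ.energy_sub_le_J h hφ
  have h4 := dirichlet_nonneg h.vol_pos hφ hψ
  have h5 := (h.MA_isProbability hψ).1.mono hle'
  have h6 := dirichlet_le_MA_sub h.vol_pos hφ hψ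
  have h7 := abs_le.1 ((h.MA_isProbability hψ).abs_le (f : C(X, ℝ)))
  have h8 := abs_le.1 ((h.MA_isProbability hφ).abs_le (f : C(X, ℝ)))
  have h9 : S.dirichlet ω φ ψ = S.mongeAmpereEnergy ω φ - S.mongeAmpereEnergy ω ψ
    + S.MA ω φ ((ψ : C(X, ℝ)) - (φ : C(X, ℝ))) := rfl
  simp only [Submodule.coe_add, Submodule.coe_smul, map_sub, map_add, map_smul, smul_eq_mul]
    at h1 h2 h5 h6 h9
  refine ⟨φ, hφ, ?_, ?_⟩
  · have h10 : t * S.MA ω φ (f : C(X, ℝ))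
        ≤ t * μ.toRadon (f : C(X, ℝ)) + μ.relJ ψ + t ^ 2 := by
      rw [relJ]; linarith
    have h11 : μ.toRadon (f : C(X, ℝ)) + μ.relJ ψ / t + t
        = (t * μ.toRadon (f : C(X, ℝ)) + μ.relJ ψ + t ^ 2) / t := by
      field_simp
    rw [h11, le_div_iff₀ ht]
    linarith
  · have h12 := mul_le_mul_of_nonneg_left h7.2 ht.le
    have h13 := mul_le_mul_of_nonneg_left h8.1 ht.le
    linarith

/-- The perturbed potential φ of `exists_MA_le` satisfies J(φ, ψ) = O(t). As f is a multiple of a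
difference of psh functions, replacing MA_φ(f) by MA_ψ(f) costs O(√t). First t is fixed, then η is
taken small relative to t. -/
lemma exists_MA_le_add (h : S.IsAdmissible ω) (μ : S.FiniteEnergyMeasure ω) (f : S.D) {ε : ℝ}
    (hε : 0 < ε) : ∃ η > 0, ∀ ψ ∈ S.psh ω, μ.relJ ψ ≤ η →
      S.MA ω ψ (f : C(X, ℝ)) ≤ μ.toRadon (f : C(X, ℝ)) + ε := by
  obtain ⟨s, hs, g₁, hg₁, g₂, hg₂, hf⟩ := S.exists_psh_sub h.mem_posCone f
  have hc := energyConst_pos n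
  have hV := h.vol_pos
  have h0 := zero_mem_psh (S := S) h.nonneg
  set c := energyConst n with hc'
  set B := c ^ 2 * (μ.J + 1)
  set A := 2 * ‖(f : C(X, ℝ))‖ + 1 with hA
  have hA0 : 0 ≤ A := by positivity
  -- `B` bounds the energy of ψ and `A` bounds J(φ, ψ); the quasi-triangle inequality through ψ
  -- makes `B'` a bound for the energy of φ.
  set B' := c ^ 2 * (c ^ 2 * B + c ^ 2 * A) with hB'
  set G := s * c ^ 2 * (√(S.potentialEnergy ω g₁ + B' + B) + √(S.potentialEnergy ω g₂ + B' + B))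
    * √(c * A) with hG
  have hcont : Tendsto (fun t : ℝ => t + G * √t) (𝓝[>] 0) (𝓝 0) := by
    have : Continuous fun t : ℝ => t + G * √t := by fun_prop
    simpa using (this.tendsto 0).mono_left nhdsWithin_le_nhds
  obtain ⟨t, ⟨ht2, ht1⟩, ht0⟩ := ((hcont.eventually_lt_const (half_pos hε)).and
    ((eventually_le_nhds (zero_lt_one (α := ℝ))).filter_mono nhdsWithin_le_nhds)
    |>.and self_mem_nhdsWithin).exists
  have ht0' : 0 < t := ht0
  refine ⟨min 1 (t * (ε / 2)), by positivity, fun ψ hψ hψη => ?_⟩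
  obtain ⟨φ, hφ, h1, h2⟩ := μ.exists_MA_le h hψ f ht0'
  have hδ : S.dirichlet ω φ ψ ≤ A * t := by
    refine h2.trans ?_
    rw [hA]; nlinarith
  have hδ1 : S.dirichlet ω φ ψ ≤ A := hδ.trans (mul_le_of_le_one_right hA0 ht1)
  have hψB : S.potentialEnergy ω ψ ≤ B := (μ.potentialEnergy_le h hψ).trans
    (mul_le_mul_of_nonneg_left (by linarith [hψη.trans (min_le_left _ _)]) (by positivity))
  have hφB : S.potentialEnergy ω φ ≤ B' := by
    have e1 := distSq_le_add hV hψ h0 hφ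
    have e2 : S.dirichlet ω ψ 0 ≤ c ^ 2 * S.potentialEnergy ω ψ := dirichlet_comm_le hV h0 hψ
    have e3 := dirichlet_comm_le hV hφ hψ
    calc S.potentialEnergy ω φ ≤ c * S.distSq ω 0 φ := dirichlet_le_distSq hV h0 hφ
      _ ≤ c * (c * (c ^ 2 * B + c ^ 2 * A)) := by
        gcongr
        refine e1.trans ?_
        gcongr
        · exact e2.trans (by gcongr)
        · exact e3.trans (by gcongr)
      _ = _ := by ring
  have hd : √(S.distSq ω φ ψ) ≤ √(c * A) * √t := by
    rw [← Real.sqrt_mul (by positivity), mul_assoc]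
    refine Real.sqrt_le_sqrt ((distSq_le_dirichlet hV hφ hψ).trans ?_)
    gcongr
  have hg : ∀ g ∈ S.psh ω, |S.MA ω φ (g : C(X, ℝ)) - S.MA ω ψ (g : C(X, ℝ))|
      ≤ c ^ 2 * (√(S.potentialEnergy ω g + B' + B) * (√(c * A) * √t)) := by
    intro g hg
    refine (abs_MA_sub_psh_le hV h.nonneg hφ hψ hg).trans ?_
    gcongr
  have hg1 := (abs_le.1 (hg g₁ hg₁)).1
  have hg2 := (abs_le.1 (hg g₂ hg₂)).2
  have hfe : S.MA ω ψ (f : C(X, ℝ)) - S.MA ω φ (f : C(X, ℝ)) ≤ G * √t := by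
    rw [hf]
    simp only [Submodule.coe_smul, Submodule.coe_sub, map_smul, map_sub, smul_eq_mul]
    have : (S.MA ω ψ (g₁ : C(X, ℝ)) - S.MA ω ψ (g₂ : C(X, ℝ)))
        - (S.MA ω φ (g₁ : C(X, ℝ)) - S.MA ω φ (g₂ : C(X, ℝ)))
        ≤ c ^ 2 * (√(S.potentialEnergy ω g₁ + B' + B) * (√(c * A) * √t))
        + c ^ 2 * (√(S.potentialEnergy ω g₂ + B' + B) * (√(c * A) * √t)) := by linarith
    have := mul_le_mul_of_nonneg_left this hs.le
    rw [hG]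
    linarith
  have h3 : μ.relJ ψ / t ≤ ε / 2 := by
    rw [div_le_iff₀ ht0']
    linarith [hψη.trans (min_le_right _ _)]
  linarith

lemma tendsto_MA_apply (h : S.IsAdmissible ω) (μ : S.FiniteEnergyMeasure ω) (f : S.D) :
    Tendsto (fun ψ : S.psh ω => S.MA ω ψ (f : C(X, ℝ))) μ.maximizing
      (𝓝 (μ.toRadon (f : C(X, ℝ)))) := by
  rw [Metric.tendsto_nhds]
  intro ε hε
  obtain ⟨η₁, hη₁, h1⟩ := μ.exists_MA_le_add h f (half_pos hε)
  obtain ⟨η₂, hη₂, h2⟩ := μ.exists_MA_le_add h (-f) (half_pos hε)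
  filter_upwards [μ.eventually_maximizing_lt hη₁, μ.eventually_maximizing_lt hη₂] with ψ e1 e2
  have h3 := h1 ψ ψ.2 e1.le
  have h4 := h2 ψ ψ.2 e2.le
  simp only [Submodule.coe_neg, map_neg] at h4
  rw [Real.dist_eq, abs_lt]
  constructor <;> linarith

/-- The Monge–Ampère measure of a potential that is almost maximizing for `μ` is close to `μ`. -/
lemma abs_MA_sub_le (h : S.IsAdmissible ω) (μ : S.FiniteEnergyMeasure ω) {φ ψ : S.D}
    (hφ : φ ∈ S.psh ω) (hψ : ψ ∈ S.psh ω) :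
    |S.MA ω ψ (φ : C(X, ℝ)) - μ.toRadon (φ : C(X, ℝ))| ≤ energyConst n ^ 4 *
      (√(S.potentialEnergy ω φ + S.potentialEnergy ω ψ + μ.J) * √(μ.relJ ψ)) := by
  have := μ.maximizing_neBot h
  have hc := energyConst_pos n
  have hc1 := one_le_energyConst n
  have hφ0 := potentialEnergy_nonneg h.vol_pos h.nonneg hφ
  have hψ0 := potentialEnergy_nonneg h.vol_pos h.nonneg hψ
  have hμ0 := μ.J_nonneg h
  have hr := μ.relJ_nonneg h hψ
  set c := energyConst n with hc'
  -- The bound for two potentials ψ, ψ' is passed to the limit as ψ' maximizes for μ: MA_ψ' tends to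
  -- μ on φ, and the energy and distance of ψ' are controlled by J(μ, ψ').
  have lim1 : Tendsto (fun ψ' : S.psh ω =>
      |S.MA ω ψ (φ : C(X, ℝ)) - S.MA ω ψ' (φ : C(X, ℝ))|) μ.maximizing
      (𝓝 |S.MA ω ψ (φ : C(X, ℝ)) - μ.toRadon (φ : C(X, ℝ))|) :=
    ((μ.tendsto_MA_apply h φ).const_sub _).abs
  set F : ℝ → ℝ := fun r => c ^ 2 * (√(S.potentialEnergy ω φ + S.potentialEnergy ω ψ
    + c ^ 2 * (μ.J + r)) * √(c * (μ.relJ ψ + r))) with hF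
  have hFc : Continuous F := by fun_prop
  have lim2 : Tendsto (fun ψ' : S.psh ω => F (μ.relJ ψ')) μ.maximizing (𝓝 (F 0)) :=
    (hFc.tendsto 0).comp μ.tendsto_relJ_maximizing
  refine (le_of_tendsto_of_tendsto' lim1 lim2 fun ψ' => ?_).trans ?_
  · refine (abs_MA_sub_psh_le h.vol_pos h.nonneg hψ ψ'.2 hφ).trans ?_
    simp only [hF]
    have e1 := μ.potentialEnergy_le h ψ'.2
    have e2 := μ.distSq_le h hψ ψ'.2
    gcongr
  · have e1 : √(S.potentialEnergy ω φ + S.potentialEnergy ω ψ + c ^ 2 * (μ.J + 0))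
        ≤ c * √(S.potentialEnergy ω φ + S.potentialEnergy ω ψ + μ.J) := by
      rw [Real.sqrt_le_left (by positivity), mul_pow, Real.sq_sqrt (by positivity)]
      have : 1 ≤ c ^ 2 := one_le_pow₀ hc1
      nlinarith
    have e2 : √(c * (μ.relJ ψ + 0)) ≤ c * √(μ.relJ ψ) := by
      rw [Real.sqrt_le_left (by positivity), mul_pow, Real.sq_sqrt hr]
      nlinarith [mul_nonneg hc.le hr]
    calc F 0 ≤ c ^ 2 * ((c * √(S.potentialEnergy ω φ + S.potentialEnergy ω ψ + μ.J))
          * (c * √(μ.relJ ψ))) := by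
          simp only [hF]; gcongr
      _ = _ := by ring

lemma relJ_sub_dirichlet (μ : S.FiniteEnergyMeasure ω) (ψ χ : S.D) :
    μ.relJ χ - S.dirichlet ω ψ χ = μ.relJ ψ
      - (S.MA ω ψ (χ : C(X, ℝ)) - μ.toRadon (χ : C(X, ℝ)))
      + (S.MA ω ψ (ψ : C(X, ℝ)) - μ.toRadon (ψ : C(X, ℝ))) := by
  simp only [relJ, dirichlet, map_sub]
  ring

/-- Modulus of continuity of `J_ω(μ, ψ)` with respect to `μ`. -/
def measureModulus (n : ℕ) (R x : ℝ) : ℝ := x + 2 * (energyConst n ^ 4 * (√(3 * R) * √x))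

lemma continuous_measureModulus (n : ℕ) (R : ℝ) : Continuous (measureModulus n R) := by
  unfold measureModulus
  fun_prop

lemma measureModulus_zero (n : ℕ) (R : ℝ) : measureModulus n R 0 = 0 := by
  simp [measureModulus]

lemma abs_relJ_sub_dirichlet_le (h : S.IsAdmissible ω) (μ : S.FiniteEnergyMeasure ω) {ψ χ : S.D}
    (hψ : ψ ∈ S.psh ω) (hχ : χ ∈ S.psh ω) {R : ℝ} (hψR : S.potentialEnergy ω ψ ≤ R)
    (hχR : S.potentialEnergy ω χ ≤ R) (hμR : μ.J ≤ R) :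
    |μ.relJ χ - S.dirichlet ω ψ χ| ≤ measureModulus n R (μ.relJ ψ) := by
  have hc := energyConst_pos n
  have h1 : ∀ φ ∈ S.psh ω, S.potentialEnergy ω φ ≤ R →
      |S.MA ω ψ (φ : C(X, ℝ)) - μ.toRadon (φ : C(X, ℝ))|
        ≤ energyConst n ^ 4 * (√(3 * R) * √(μ.relJ ψ)) := fun φ hφ hφR => by
    refine (μ.abs_MA_sub_le h hφ hψ).trans ?_
    gcongr
    linarith
  have h2 := abs_le.1 (h1 χ hχ hχR)
  have h3 := abs_le.1 (h1 ψ hψ hψR)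
  have h4 := μ.relJ_nonneg h hψ
  rw [relJ_sub_dirichlet, measureModulus, abs_le]
  constructor <;> linarith [h2.1, h2.2, h3.1, h3.2]

lemma tendsto_dirichlet (h : S.IsAdmissible ω) (μ : S.FiniteEnergyMeasure ω) {χ : S.D}
    (hχ : χ ∈ S.psh ω) :
    Tendsto (fun ψ : S.psh ω => S.dirichlet ω ψ χ) μ.maximizing (𝓝 (μ.relJ χ)) := by
  rw [tendsto_iff_dist_tendsto_zero]
  have hc := energyConst_pos n
  have hc1 : 1 ≤ energyConst n ^ 2 := one_le_pow₀ (one_le_energyConst n)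
  have hμ0 := μ.J_nonneg h
  have hχ0 := potentialEnergy_nonneg h.vol_pos h.nonneg hχ
  set R := S.potentialEnergy ω χ + energyConst n ^ 2 * (μ.J + 1) with hR
  have lim := ((continuous_measureModulus n R).tendsto 0).comp μ.tendsto_relJ_maximizing
  rw [measureModulus_zero] at lim
  refine squeeze_zero' (Eventually.of_forall fun _ => dist_nonneg) ?_ lim
  filter_upwards [μ.eventually_maximizing_lt one_pos] with ψ hψ
  rw [dist_comm, Real.dist_eq]
  refine μ.abs_relJ_sub_dirichlet_le h ψ.2 hχ ?_ ?_ ?_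
  · have : energyConst n ^ 2 * (μ.J + μ.relJ ψ) ≤ energyConst n ^ 2 * (μ.J + 1) := by gcongr
    linarith [μ.potentialEnergy_le h ψ.2]
  · nlinarith
  · nlinarith

end FiniteEnergyMeasure

/-! ### Uniform continuity of J(μ, ·) for `distSq` on potentials of bounded energy. -/

/-- Modulus of continuity of `J_ω(μ, ψ)` with respect to `ψ`. -/
def potentialModulus (n : ℕ) (R x : ℝ) : ℝ :=
  energyConst n * x + energyConst n * (√((exchangeModulus n (2 * energyConst n * R))^[n] x)
    * √(2 * energyConst n * R))

lemma continuous_potentialModulus (n : ℕ) (R : ℝ) : Continuous (potentialModulus n R) := by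
  unfold potentialModulus
  have := (continuous_exchangeModulus n (2 * energyConst n * R)).iterate n
  fun_prop

lemma potentialModulus_zero (n : ℕ) (R : ℝ) : potentialModulus n R 0 = 0 := by
  rw [potentialModulus, Function.iterate_fixed (exchangeModulus_zero n _)]
  simp

lemma potentialModulus_mono (n : ℕ) {R : ℝ} (hR : 0 ≤ R) : Monotone (potentialModulus n R) := by
  intro x y hxy
  have := energyConst_pos n
  have h1 := ((exchangeModulus_mono n (show 0 ≤ 2 * energyConst n * R by positivity)).iterate n) hxy
  unfold potentialModulus
  gcongr

lemma abs_dirichlet_sub_le (h : S.IsAdmissible ω) {p a b : S.D} (hp : p ∈ S.psh ω)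
    (ha : a ∈ S.psh ω) (hb : b ∈ S.psh ω) {R : ℝ} (hpR : S.potentialEnergy ω p ≤ R)
    (haR : S.potentialEnergy ω a ≤ R) (hbR : S.potentialEnergy ω b ≤ R) :
    |S.dirichlet ω p a - S.dirichlet ω p b| ≤ potentialModulus n R (S.distSq ω a b) := by
  have hc := energyConst_pos n
  have hV := h.vol_pos
  have h0 := zero_mem_psh (S := S) h.nonneg
  have hd := distSq_nonneg hV ha hb
  have hdist : ∀ {x y : S.D}, x ∈ S.psh ω → y ∈ S.psh ω → S.potentialEnergy ω x ≤ R →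
      S.potentialEnergy ω y ≤ R → S.distSq ω x y ≤ 2 * energyConst n * R := by
    intro x y hx hy hxR hyR
    refine (distSq_le_add hV h0 hx hy).trans ?_
    have := mul_le_mul_of_nonneg_left (add_le_add hxR hyR) hc.le
    simp only [potentialEnergy] at this
    linarith
  have hpb := mid_mem_psh hp hb
  have hab := mid_mem_psh ha hb
  -- Cauchy–Schwarz reduces the second term to the norm of a - b at the midpoint of p and b.
  -- Energies only bound that norm; `normSq_sub_le_iterate` makes it small with `distSq ω a b`.
  have e1 : S.dirichlet ω p a - S.dirichlet ω p b = S.dirichlet ω b a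
      + (S.MA ω p ((a - b : S.D) : C(X, ℝ)) - S.MA ω b ((a - b : S.D) : C(X, ℝ))) := by
    simp only [dirichlet, map_sub, Submodule.coe_sub]
    ring
  have e2 := dirichlet_le_distSq hV hb ha
  rw [distSq_comm] at e2
  have e3 := normSq_sub_le_iterate hV hpb ha hb
  have hM := hdist hpb hab
    ((potentialEnergy_mid_le hV hp hb).trans (by linarith))
    ((potentialEnergy_mid_le hV ha hb).trans (by linarith))
  have hM0 := distSq_nonneg hV hpb hab
  have e4 : (exchangeModulus n (S.distSq ω (S.mid p b) (S.mid a b)))^[n] (S.distSq ω a b)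
      ≤ (exchangeModulus n (2 * energyConst n * R))^[n] (S.distSq ω a b) := by
    refine Monotone.iterate_le_of_le (exchangeModulus_mono n hM0) (fun x => ?_) n _
    -- Comparing iterates requires the inequality at every real x; for negative x both square roots
    -- are 0.
    by_cases hx : 0 ≤ x
    · unfold exchangeModulus
      gcongr
    · unfold exchangeModulus
      rw [Real.sqrt_eq_zero_of_nonpos, Real.sqrt_eq_zero_of_nonpos]
      · have := hM0.trans hM
        have : (0 : ℝ) ≤ 4 ^ (n - 1) * (2 * energyConst n * R) := by positivity
        nlinarith
      · have : (0 : ℝ) ≤ 4 ^ (n - 1) * S.distSq ω (S.mid p b) (S.mid a b) := by positivity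
        nlinarith
  have e5 := abs_MA_sub_le_distSq hV hp hb (a - b)
  have e6 : energyConst n * (√(S.normSq ω (S.mid p b) (a - b)) * √(S.distSq ω p b))
      ≤ energyConst n * (√((exchangeModulus n (2 * energyConst n * R))^[n] (S.distSq ω a b))
        * √(2 * energyConst n * R)) := by
    have := e3.trans e4
    have := hdist hp hb hpR hbR
    gcongr
  rw [e1, potentialModulus]
  refine (abs_add_le _ _).trans (add_le_add ?_ (e5.trans e6))
  rwa [abs_of_nonneg (dirichlet_nonneg hV hb ha)]

lemma FiniteEnergyMeasure.abs_relJ_sub_le (h : S.IsAdmissible ω) (μ : S.FiniteEnergyMeasure ω)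
    {a b : S.D} (ha : a ∈ S.psh ω) (hb : b ∈ S.psh ω) {R : ℝ}
    (hμR : energyConst n ^ 2 * (μ.J + 1) ≤ R) (haR : S.potentialEnergy ω a ≤ R)
    (hbR : S.potentialEnergy ω b ≤ R) :
    |μ.relJ a - μ.relJ b| ≤ potentialModulus n R (S.distSq ω a b) := by
  have := μ.maximizing_neBot h
  have hc := energyConst_pos n
  refine le_of_tendsto ((μ.tendsto_dirichlet h ha).sub (μ.tendsto_dirichlet h hb)).abs ?_
  filter_upwards [μ.eventually_maximizing_lt one_pos] with p hp
  refine abs_dirichlet_sub_le h p.2 ha hb ((μ.potentialEnergy_le h p.2).trans (le_trans ?_ hμR))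
    haR hbR
  gcongr

end PluriData

/-! ### The Dirichlet quasi-metric: existence, continuity, quasi-triangle inequality. -/

namespace PluriData

variable {X : Type*} [TopologicalSpace X] [CompactSpace X]
  {Z : Type*} [AddCommGroup Z] [Module ℝ Z] [PartialOrder Z] {n : ℕ}
  {S : PluriData X Z n} {ω : Z} [IsOrderedAddMonoid Z] [IsOrderedModule ℝ Z] [NeZero n]

namespace FiniteEnergyMeasure

/-- Maximizing potentials of ν are close for `distSq`, and J(μ, ·) is uniformly continuous for it at
bounded energy, so the values form a Cauchy filter in ℝ. -/
lemma tendsto_dirichletQM (h : S.IsAdmissible ω) (μ ν : S.FiniteEnergyMeasure ω) :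
    Tendsto (fun ψ : S.psh ω => μ.relJ ψ) ν.maximizing (𝓝 (S.dirichletQM ω μ ν)) := by
  rw [dirichletQM_eq_limUnder h]
  have := ν.maximizing_neBot h
  refine tendsto_nhds_limUnder (cauchy_iff_exists_le_nhds.1 (Metric.cauchy_iff.2
    ⟨inferInstance, fun ε hε => ?_⟩))
  have hc := energyConst_pos n
  have hμ0 := μ.J_nonneg h
  have hν0 := ν.J_nonneg h
  set R := energyConst n ^ 2 * (μ.J + ν.J + 1) with hR
  have hR0 : 0 ≤ R := by positivity
  have lim := (continuous_potentialModulus n R).tendsto 0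
  rw [potentialModulus_zero] at lim
  obtain ⟨ρ, hρ, hρε⟩ := Metric.eventually_nhds_iff.1 (lim.eventually_lt_const hε)
  set η := min 1 (ρ / (4 * energyConst n)) with hη
  have hη0 : 0 < η := by positivity
  refine ⟨_, image_mem_map (ν.eventually_maximizing_lt hη0), ?_⟩
  rintro _ ⟨ψ, hψ, rfl⟩ _ ⟨ψ', hψ', rfl⟩
  have hψ1 : ν.relJ ψ < η := hψ
  have hψ1' : ν.relJ ψ' < η := hψ'
  have hJ : ∀ χ : S.psh ω, ν.relJ χ < η → S.potentialEnergy ω χ ≤ R := fun χ hχ => by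
    refine (ν.potentialEnergy_le h χ.2).trans ?_
    have := hχ.le.trans (min_le_left _ _)
    rw [hR]
    gcongr
    linarith
  have h1 := μ.abs_relJ_sub_le h ψ.2 ψ'.2 (R := R) (by rw [hR]; gcongr; linarith)
    (hJ ψ hψ1) (hJ ψ' hψ1')
  refine lt_of_le_of_lt h1 (hρε ?_)
  have h2 := distSq_nonneg h.vol_pos ψ.2 ψ'.2
  rw [Real.dist_eq, sub_zero, abs_of_nonneg h2]
  have h3 : η ≤ ρ / (4 * energyConst n) := min_le_right _ _
  calc S.distSq ω ψ ψ' ≤ energyConst n * (ν.relJ ψ + ν.relJ ψ') := ν.distSq_le h ψ.2 ψ'.2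
    _ ≤ energyConst n * (ρ / (4 * energyConst n) + ρ / (4 * energyConst n)) := by
      gcongr <;> linarith
    _ = ρ / 2 := by field_simp; ring
    _ < ρ := by linarith

/-- The error depends on the measures only through an energy bound and the numbers J(μ, φ), J(ν, ψ),
all controlled by the strong topology. This uniformity yields joint continuity. -/
lemma abs_dirichletQM_sub_le (h : S.IsAdmissible ω) (μ ν : S.FiniteEnergyMeasure ω) {φ ψ : S.D}
    (hφ : φ ∈ S.psh ω) (hψ : ψ ∈ S.psh ω) {R : ℝ} (hμR : energyConst n ^ 2 * (μ.J + 1) ≤ R)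
    (hνR : energyConst n ^ 2 * (ν.J + 1) ≤ R) (hφ1 : μ.relJ φ ≤ 1) (hψ1 : ν.relJ ψ ≤ 1) :
    |S.dirichletQM ω μ ν - S.dirichlet ω φ ψ| ≤
      potentialModulus n R (energyConst n * ν.relJ ψ) + measureModulus n R (μ.relJ φ) := by
  have := ν.maximizing_neBot h
  have hc := energyConst_pos n
  have hc1 : 1 ≤ energyConst n ^ 2 := one_le_pow₀ (one_le_energyConst n)
  have hμ0 := μ.J_nonneg h
  have hν0 := ν.J_nonneg h
  have hR0 : 0 ≤ R := le_trans (by positivity) hμR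
  have hJ : ∀ χ ∈ S.psh ω, ν.relJ χ ≤ 1 → S.potentialEnergy ω χ ≤ R := fun χ hχ hχ1 =>
    (ν.potentialEnergy_le h hχ).trans (le_trans (by gcongr) hνR)
  have hφJ : S.potentialEnergy ω φ ≤ R :=
    (μ.potentialEnergy_le h hφ).trans (le_trans (by gcongr) hμR)
  have h1 : |S.dirichletQM ω μ ν - μ.relJ ψ| ≤ potentialModulus n R (energyConst n * ν.relJ ψ) := by
    have lim1 := ((μ.tendsto_dirichletQM h ν).sub_const (μ.relJ ψ)).abs
    have hcont : Continuous fun r => potentialModulus n R (energyConst n * (r + ν.relJ ψ)) := by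
      have := continuous_potentialModulus n R
      fun_prop
    have lim2 := (hcont.tendsto 0).comp ν.tendsto_relJ_maximizing
    rw [zero_add] at lim2
    refine le_of_tendsto_of_tendsto lim1 lim2 ?_
    filter_upwards [ν.eventually_maximizing_lt one_pos] with ψ' hψ'
    exact (μ.abs_relJ_sub_le h ψ'.2 hψ hμR (hJ _ ψ'.2 hψ'.le) (hJ _ hψ hψ1)).trans
      (potentialModulus_mono n hR0 (ν.distSq_le h ψ'.2 hψ))
  have h2 := μ.abs_relJ_sub_dirichlet_le h hφ hψ hφJ (hJ _ hψ hψ1) (by nlinarith)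
  calc _ ≤ |S.dirichletQM ω μ ν - μ.relJ ψ| + |μ.relJ ψ - S.dirichlet ω φ ψ| := abs_sub_le _ _ _
    _ ≤ _ := add_le_add h1 h2

/-- The error bound in the approximation of the Dirichlet quasi-metric by potentials. -/
lemma tendsto_modulus (n : ℕ) (R : ℝ) : Tendsto (fun p : ℝ × ℝ =>
    potentialModulus n R (energyConst n * p.2) + measureModulus n R p.1) (𝓝 0) (𝓝 0) := by
  have h1 := continuous_potentialModulus n R
  have h2 := continuous_measureModulus n R
  have h3 : Continuous fun p : ℝ × ℝ =>
    potentialModulus n R (energyConst n * p.2) + measureModulus n R p.1 := by fun_prop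
  simpa [potentialModulus_zero, measureModulus_zero] using h3.tendsto 0

lemma tendsto_dirichlet_prod (h : S.IsAdmissible ω) (μ ν : S.FiniteEnergyMeasure ω) :
    Tendsto (fun p : S.psh ω × S.psh ω => S.dirichlet ω p.1 p.2) (μ.maximizing ×ˢ ν.maximizing)
      (𝓝 (S.dirichletQM ω μ ν)) := by
  rw [tendsto_iff_dist_tendsto_zero]
  have hμ0 := μ.J_nonneg h
  have hν0 := ν.J_nonneg h
  have hc := energyConst_pos n
  set R := energyConst n ^ 2 * (μ.J + ν.J + 1) with hR
  have lim := (tendsto_modulus n R).comp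
    ((μ.tendsto_relJ_maximizing.comp tendsto_fst).prodMk_nhds
      (ν.tendsto_relJ_maximizing.comp tendsto_snd) :
      Tendsto _ (μ.maximizing ×ˢ ν.maximizing) _)
  refine squeeze_zero' (Eventually.of_forall fun _ => dist_nonneg) ?_ lim
  filter_upwards [(μ.eventually_maximizing_lt one_pos).prod_mk
    (ν.eventually_maximizing_lt one_pos)] with p hp
  rw [dist_comm]
  refine μ.abs_dirichletQM_sub_le h ν p.1.2 p.2.2 ?_ ?_ hp.1.le hp.2.le
  · rw [hR]; gcongr; linarith
  · rw [hR]; gcongr; linarith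

lemma continuous_J : Continuous (fun μ : S.FiniteEnergyMeasure ω => μ.J) :=
  continuous_iff_le_induced.2 inf_le_right

lemma continuous_toRadon_apply (f : C(X, ℝ)) :
    Continuous (fun μ : S.FiniteEnergyMeasure ω => μ.toRadon f) :=
  (WeakDual.eval_continuous f).comp (continuous_iff_le_induced.2 inf_le_left)

lemma continuous_relJ (ψ : S.D) : Continuous (fun μ : S.FiniteEnergyMeasure ω => μ.relJ ψ) := by
  unfold relJ
  exact (continuous_J.sub continuous_const).add (continuous_toRadon_apply _)

/-- For a fixed potential φ, μ ↦ J(μ, φ) is strongly continuous, so potentials almost maximizing at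
a point remain so nearby, and one value J(φ, ψ) approximates δ on a whole neighbourhood. -/
lemma continuous_dirichletQM (h : S.IsAdmissible ω) :
    Continuous (fun p : S.FiniteEnergyMeasure ω × S.FiniteEnergyMeasure ω =>
      S.dirichletQM ω p.1 p.2) := by
  rw [continuous_iff_continuousAt]
  rintro ⟨μ₀, ν₀⟩
  rw [ContinuousAt, Metric.tendsto_nhds]
  intro ε hε
  have hμ0 := μ₀.J_nonneg h
  have hν0 := ν₀.J_nonneg h
  have hc := energyConst_pos n
  set R := energyConst n ^ 2 * (μ₀.J + ν₀.J + 2) with hR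
  obtain ⟨ρ, hρ, hρε⟩ := Metric.eventually_nhds_iff.1
    ((tendsto_modulus n R).eventually_lt_const (half_pos hε))
  set η := min 1 ρ with hη
  have hη0 : 0 < η := by positivity
  obtain ⟨φ, hφ, hφη⟩ := μ₀.exists_relJ_lt h hη0
  obtain ⟨ψ, hψ, hψη⟩ := ν₀.exists_relJ_lt h hη0
  have key : ∀ μ ν : S.FiniteEnergyMeasure ω, μ.J < μ₀.J + 1 → ν.J < ν₀.J + 1 → μ.relJ φ < η →
      ν.relJ ψ < η → |S.dirichletQM ω μ ν - S.dirichlet ω φ ψ| < ε / 2 := by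
    intro μ ν e1 e2 e3 e4
    refine (μ.abs_dirichletQM_sub_le h ν hφ hψ (R := R) ?_ ?_ (e3.le.trans (min_le_left _ _))
      (e4.le.trans (min_le_left _ _))).trans_lt (hρε (y := (μ.relJ φ, ν.relJ ψ)) ?_)
    · rw [hR]; exact mul_le_mul_of_nonneg_left (by linarith) (by positivity)
    · rw [hR]; exact mul_le_mul_of_nonneg_left (by linarith) (by positivity)
    · rw [dist_zero_right, Prod.norm_def, max_lt_iff, Real.norm_eq_abs, Real.norm_eq_abs,
        abs_of_nonneg (μ.relJ_nonneg h hφ), abs_of_nonneg (ν.relJ_nonneg h hψ)]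
      exact ⟨e3.trans_le (min_le_right _ _), e4.trans_le (min_le_right _ _)⟩
  have e1 := (continuous_J.tendsto μ₀).eventually_lt_const (show μ₀.J < μ₀.J + 1 by linarith)
  have e2 := (continuous_J.tendsto ν₀).eventually_lt_const (show ν₀.J < ν₀.J + 1 by linarith)
  have e3 := ((continuous_relJ φ).tendsto μ₀).eventually_lt_const hφη
  have e4 := ((continuous_relJ ψ).tendsto ν₀).eventually_lt_const hψη
  rw [nhds_prod_eq]
  filter_upwards [(e1.and e3).prod_mk (e2.and e4)] with p hp
  have h1 := abs_lt.1 (key p.1 p.2 hp.1.1 hp.2.1 hp.1.2 hp.2.2)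
  have h2 := abs_lt.1 (key μ₀ ν₀ (by linarith) (by linarith) hφη hψη)
  rw [Real.dist_eq, abs_lt]
  constructor <;> linarith [h1.1, h1.2, h2.1, h2.2]

/-- The constant filter at ψ is maximizing for MA(ψ), since J(ψ, ψ) = 0. -/
lemma dirichletQM_toMeasure_right (h : S.IsAdmissible ω) (μ : S.FiniteEnergyMeasure ω)
    (ψ : S.psh ω) : S.dirichletQM ω μ (h.toMeasure ψ) = μ.relJ ψ := by
  have h1 : pure ψ ≤ (h.toMeasure ψ).maximizing := by
    rw [maximizing, ← map_le_iff_le_comap, map_pure, h.relJ_toMeasure, dirichlet_self]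
    exact pure_le_nhds 0
  exact tendsto_nhds_unique ((μ.tendsto_dirichletQM h _).mono_left h1)
    (tendsto_pure_nhds (fun ψ : S.psh ω => μ.relJ ψ) ψ)

lemma extendsDirichlet_dirichletQM (h : S.IsAdmissible ω) :
    S.ExtendsDirichlet ω (S.dirichletQM ω) :=
  ⟨continuous_dirichletQM h, fun φ hφ ψ hψ => ⟨h.toMeasure ⟨φ, hφ⟩, h.toMeasure ⟨ψ, hψ⟩, rfl, rfl, by
    rw [dirichletQM_toMeasure_right, h.relJ_toMeasure]⟩⟩

lemma dirichletQM_nonneg (h : S.IsAdmissible ω) (μ ν : S.FiniteEnergyMeasure ω) :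
    0 ≤ S.dirichletQM ω μ ν := by
  have := ν.maximizing_neBot h
  exact ge_of_tendsto' (μ.tendsto_dirichletQM h ν) fun ψ => μ.relJ_nonneg h ψ.2

lemma dirichletQM_comm_le (h : S.IsAdmissible ω) (μ ν : S.FiniteEnergyMeasure ω) :
    S.dirichletQM ω ν μ ≤ energyConst n ^ 2 * S.dirichletQM ω μ ν := by
  have := ν.maximizing_neBot h
  have := μ.maximizing_neBot h
  exact le_of_tendsto_of_tendsto' ((ν.tendsto_dirichlet_prod h μ).comp tendsto_prod_swap)
    ((μ.tendsto_dirichlet_prod h ν).const_mul _) fun p => dirichlet_comm_le h.vol_pos p.1.2 p.2.2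

lemma dirichletQM_triangle (h : S.IsAdmissible ω) (μ ν ρ : S.FiniteEnergyMeasure ω) :
    S.dirichletQM ω μ ν ≤ energyConst n ^ 4 * (S.dirichletQM ω μ ρ + S.dirichletQM ω ρ ν) := by
  have := ν.maximizing_neBot h
  have := μ.maximizing_neBot h
  have := ρ.maximizing_neBot h
  have hc := energyConst_pos n
  have t12 : Tendsto (fun p : S.psh ω × S.psh ω × S.psh ω => (p.1, p.2.2))
      (μ.maximizing ×ˢ ρ.maximizing ×ˢ ν.maximizing) (μ.maximizing ×ˢ ν.maximizing) :=
    tendsto_fst.prodMk (tendsto_snd.comp tendsto_snd)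
  have t13 : Tendsto (fun p : S.psh ω × S.psh ω × S.psh ω => (p.1, p.2.1))
      (μ.maximizing ×ˢ ρ.maximizing ×ˢ ν.maximizing) (μ.maximizing ×ˢ ρ.maximizing) :=
    tendsto_fst.prodMk (tendsto_fst.comp tendsto_snd)
  refine le_of_tendsto_of_tendsto' ((μ.tendsto_dirichlet_prod h ν).comp t12)
    ((((μ.tendsto_dirichlet_prod h ρ).comp t13).add
      ((ρ.tendsto_dirichlet_prod h ν).comp tendsto_snd)).const_mul _) fun ⟨φ, χ, ψ⟩ => ?_
  have h1 := dirichlet_le_distSq h.vol_pos φ.2 ψ.2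
  have h2 := distSq_le_add h.vol_pos χ.2 φ.2 ψ.2
  have h3 := dirichlet_comm_le h.vol_pos φ.2 χ.2
  have h4 := dirichlet_nonneg h.vol_pos χ.2 ψ.2
  have hc1 : 1 ≤ energyConst n ^ 2 := one_le_pow₀ (one_le_energyConst n)
  simp only [Function.comp_apply]
  calc S.dirichlet ω φ ψ
      ≤ energyConst n * (energyConst n * (energyConst n ^ 2 * S.dirichlet ω φ χ
        + energyConst n ^ 2 * S.dirichlet ω χ ψ)) := by
        refine h1.trans ?_
        gcongr
        refine h2.trans ?_
        gcongr
        nlinarith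
    _ = _ := by ring

/-! ### The dual distance and its comparison with the Dirichlet quasi-metric. -/

/-- The supremum of `|∫ φ (μ - ν)|` over all `φ ∈ D_ω` with `J_ω(φ) ≤ 1`, as a real number. -/
def dualDist (μ ν : S.FiniteEnergyMeasure ω) : ℝ := (S.dualDist ω μ ν).toReal

lemma dualDist_nonneg (μ ν : S.FiniteEnergyMeasure ω) : 0 ≤ μ.dualDist ν := ENNReal.toReal_nonneg

lemma dualDist_le_ofReal {μ ν : S.FiniteEnergyMeasure ω} {r : ℝ}
    (H : ∀ φ ∈ S.psh ω, S.potentialEnergy ω φ ≤ 1 →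
      |μ.toRadon (φ : C(X, ℝ)) - ν.toRadon (φ : C(X, ℝ))| ≤ r) :
    S.dualDist ω μ ν ≤ ENNReal.ofReal r :=
  iSup_le fun φ => ENNReal.ofReal_le_ofReal (H φ.1 φ.2.1 φ.2.2)

lemma dualDist_le {μ ν : S.FiniteEnergyMeasure ω} {r : ℝ} (hr : 0 ≤ r)
    (H : ∀ φ ∈ S.psh ω, S.potentialEnergy ω φ ≤ 1 →
      |μ.toRadon (φ : C(X, ℝ)) - ν.toRadon (φ : C(X, ℝ))| ≤ r) : μ.dualDist ν ≤ r :=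
  ENNReal.toReal_le_of_le_ofReal hr (dualDist_le_ofReal H)

/-- The distance of `μ` to the Monge–Ampère measure of a potential is controlled by the energy. -/
lemma abs_sub_MA_le (h : S.IsAdmissible ω) (μ : S.FiniteEnergyMeasure ω) {φ ψ : S.D}
    (hφ : φ ∈ S.psh ω) (hφ1 : S.potentialEnergy ω φ ≤ 1) (hψ : ψ ∈ S.psh ω) :
    |μ.toRadon (φ : C(X, ℝ)) - S.MA ω ψ (φ : C(X, ℝ))| ≤ energyConst n ^ 4 *
      (√(1 + energyConst n ^ 2 * (μ.J + μ.relJ ψ) + μ.J) * √(μ.relJ ψ)) := by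
  rw [abs_sub_comm]
  have hc := energyConst_pos n
  have h1 := μ.potentialEnergy_le h hψ
  refine (μ.abs_MA_sub_le h hφ hψ).trans ?_
  gcongr

/-- Both measures are compared with MA(0), at a cost depending only on their energies. -/
lemma dualDist_ne_top (h : S.IsAdmissible ω) (μ ν : S.FiniteEnergyMeasure ω) :
    S.dualDist ω μ ν ≠ ⊤ := by
  have h0 := zero_mem_psh (S := S) h.nonneg
  refine ne_top_of_le_ne_top (ENNReal.ofReal_ne_top (r :=
    energyConst n ^ 4 * (√(1 + energyConst n ^ 2 * (μ.J + μ.relJ 0) + μ.J) * √(μ.relJ 0))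
      + energyConst n ^ 4 * (√(1 + energyConst n ^ 2 * (ν.J + ν.relJ 0) + ν.J) * √(ν.relJ 0))))
    (dualDist_le_ofReal fun φ hφ hφ1 => ?_)
  · have h1 := μ.abs_sub_MA_le h hφ hφ1 h0
    have h2 := ν.abs_sub_MA_le h hφ hφ1 h0
    rw [abs_sub_comm] at h2
    exact (abs_sub_le _ _ _).trans (add_le_add h1 h2)

lemma ofReal_dualDist (h : S.IsAdmissible ω) (μ ν : S.FiniteEnergyMeasure ω) :
    ENNReal.ofReal (μ.dualDist ν) = S.dualDist ω μ ν := ENNReal.ofReal_toReal (dualDist_ne_top h μ ν)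

lemma abs_sub_le_dualDist_of_le_one (h : S.IsAdmissible ω) (μ ν : S.FiniteEnergyMeasure ω) {φ : S.D}
    (hφ : φ ∈ S.psh ω) (hφ1 : S.potentialEnergy ω φ ≤ 1) :
    |μ.toRadon (φ : C(X, ℝ)) - ν.toRadon (φ : C(X, ℝ))| ≤ μ.dualDist ν :=
  (ENNReal.ofReal_le_iff_le_toReal (dualDist_ne_top h μ ν)).1
    (le_iSup (fun φ : {φ : S.D // φ ∈ S.psh ω ∧ S.potentialEnergy ω φ ≤ 1} =>
      ENNReal.ofReal |μ.toRadon (φ.1 : C(X, ℝ)) - ν.toRadon (φ.1 : C(X, ℝ))|) ⟨φ, hφ, hφ1⟩)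

lemma abs_sub_le_dualDist (h : S.IsAdmissible ω) (μ ν : S.FiniteEnergyMeasure ω) {φ : S.D}
    (hφ : φ ∈ S.psh ω) : |μ.toRadon (φ : C(X, ℝ)) - ν.toRadon (φ : C(X, ℝ))| ≤
      energyConst n ^ 2 * (√(S.potentialEnergy ω φ) + 1) * μ.dualDist ν := by
  have hc1 := one_le_energyConst n
  have hc := energyConst_pos n
  set c := energyConst n with hc'
  set j := S.potentialEnergy ω φ with hj
  have hj0 : 0 ≤ j := potentialEnergy_nonneg h.vol_pos h.nonneg hφ
  -- With this scaling, J(φ/s) ≤ c³ j / s² ≤ 1, so φ/s is admissible in the supremum.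
  set s := c ^ 2 * (√j + 1) with hs
  have hs1 : 1 ≤ s := by
    have : 1 ≤ c ^ 2 := one_le_pow₀ hc1
    nlinarith [Real.sqrt_nonneg j]
  have hs0 : 0 < s := by linarith
  have hsφ := smul_mem_psh h.nonneg hφ (inv_nonneg.2 hs0.le) (inv_le_one_of_one_le₀ hs1)
  have h1 : S.potentialEnergy ω (s⁻¹ • φ) ≤ 1 := by
    refine (potentialEnergy_smul_le h.vol_pos h.nonneg hφ (inv_nonneg.2 hs0.le)
      (inv_le_one_of_one_le₀ hs1)).trans ?_
    rw [← hc', ← hj, inv_pow, inv_mul_eq_div, mul_div_assoc', div_le_one (by positivity)]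
    have h2 : j ≤ (√j + 1) ^ 2 := by nlinarith [Real.sqrt_nonneg j, Real.sq_sqrt hj0]
    calc c ^ 3 * j ≤ c ^ 4 * (√j + 1) ^ 2 := by
          gcongr
          norm_num
      _ = s ^ 2 := by rw [hs]; ring
  have h2 := abs_sub_le_dualDist_of_le_one h μ ν hsφ h1
  simp only [Submodule.coe_smul, map_smul, smul_eq_mul] at h2
  rwa [← mul_sub, abs_mul, abs_of_pos (inv_pos.2 hs0), inv_mul_le_iff₀ hs0] at h2

lemma dualDist_self (μ : S.FiniteEnergyMeasure ω) : μ.dualDist μ = 0 :=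
  le_antisymm (dualDist_le le_rfl fun φ _ _ => by simp) (dualDist_nonneg _ _)

lemma dualDist_comm (μ ν : S.FiniteEnergyMeasure ω) : μ.dualDist ν = ν.dualDist μ := by
  simp only [dualDist, PluriData.dualDist, abs_sub_comm]

lemma dualDist_triangle (h : S.IsAdmissible ω) (μ ν ρ : S.FiniteEnergyMeasure ω) :
    μ.dualDist ρ ≤ μ.dualDist ν + ν.dualDist ρ :=
  dualDist_le (add_nonneg (dualDist_nonneg _ _) (dualDist_nonneg _ _)) fun _ hφ hφ1 =>
    (abs_sub_le _ _ _).trans (add_le_add (abs_sub_le_dualDist_of_le_one h μ ν hφ hφ1)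
      (abs_sub_le_dualDist_of_le_one h ν ρ hφ hφ1))

/-- Integrals of test functions are Lipschitz for the dual distance. -/
lemma exists_abs_sub_le_dualDist (h : S.IsAdmissible ω) (f : S.D) : ∃ L : ℝ, 0 ≤ L ∧
    ∀ μ ν : S.FiniteEnergyMeasure ω,
      |μ.toRadon (f : C(X, ℝ)) - ν.toRadon (f : C(X, ℝ))| ≤ L * μ.dualDist ν := by
  obtain ⟨s, hs, g₁, hg₁, g₂, hg₂, rfl⟩ := S.exists_psh_sub h.mem_posCone f
  refine ⟨s * (energyConst n ^ 2 * (√(S.potentialEnergy ω g₁) + 1)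
    + energyConst n ^ 2 * (√(S.potentialEnergy ω g₂) + 1)), by positivity, fun μ ν => ?_⟩
  have h1 := abs_sub_le_dualDist h μ ν hg₁
  have h2 := abs_sub_le_dualDist h μ ν hg₂
  have e : μ.toRadon ((s • (g₁ - g₂) : S.D) : C(X, ℝ))
      - ν.toRadon ((s • (g₁ - g₂) : S.D) : C(X, ℝ))
      = s * ((μ.toRadon (g₁ : C(X, ℝ)) - ν.toRadon (g₁ : C(X, ℝ)))
        - (μ.toRadon (g₂ : C(X, ℝ)) - ν.toRadon (g₂ : C(X, ℝ)))) := by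
    simp only [Submodule.coe_smul, Submodule.coe_sub, map_smul, map_sub, smul_eq_mul]
    ring
  rw [e, abs_mul, abs_of_pos hs, mul_assoc, add_mul]
  exact mul_le_mul_of_nonneg_left ((abs_sub _ _).trans (add_le_add h1 h2)) hs.le

lemma eq_of_dualDist_eq_zero (h : S.IsAdmissible ω) {μ ν : S.FiniteEnergyMeasure ω}
    (h0 : μ.dualDist ν = 0) : μ = ν := by
  apply FiniteEnergyMeasure.ext
  refine DFunLike.coe_injective (Continuous.ext_on S.dense_D (map_continuous μ.toRadon)
    (map_continuous ν.toRadon) fun f hf => ?_)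
  obtain ⟨L, -, hL⟩ := exists_abs_sub_le_dualDist h ⟨f, hf⟩
  have := hL μ ν
  rw [h0, mul_zero] at this
  exact sub_eq_zero.1 (abs_eq_zero.1 (le_antisymm this (abs_nonneg _)))

/-- Let ψ maximize for ν in `abs_MA_sub_le` for μ: MA_ψ(φ) tends to ν(φ) and J(μ, ψ) tends to δ(μ,
ν). -/
lemma dualDist_le_sqrt_dirichletQM (h : S.IsAdmissible ω) {μ ν : S.FiniteEnergyMeasure ω} {R : ℝ}
    (hR : 1 ≤ R) (hμ : μ.J ≤ R) (hν : ν.J ≤ R) :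
    μ.dualDist ν ≤ 2 * energyConst n ^ 5 * √(S.dirichletQM ω μ ν) * √R := by
  have := ν.maximizing_neBot h
  have hc1 := one_le_energyConst n
  have hc := energyConst_pos n
  set c := energyConst n with hc'
  refine dualDist_le (by positivity) fun φ hφ hφ1 => ?_
  have lim1 : Tendsto (fun ψ : S.psh ω =>
      |μ.toRadon (φ : C(X, ℝ)) - S.MA ω ψ (φ : C(X, ℝ))|) ν.maximizing
      (𝓝 |μ.toRadon (φ : C(X, ℝ)) - ν.toRadon (φ : C(X, ℝ))|) :=
    ((ν.tendsto_MA_apply h φ).const_sub _).abs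
  have lim2 : Tendsto (fun ψ : S.psh ω => c ^ 4 *
      (√(1 + c ^ 2 * (R + ν.relJ ψ) + R) * √(μ.relJ ψ))) ν.maximizing
      (𝓝 (c ^ 4 * (√(1 + c ^ 2 * (R + 0) + R) * √(S.dirichletQM ω μ ν)))) :=
    (((((ν.tendsto_relJ_maximizing.const_add R).const_mul _).const_add 1).add_const R).sqrt.mul
      (μ.tendsto_dirichletQM h ν).sqrt).const_mul _
  refine (le_of_tendsto_of_tendsto' lim1 lim2 fun ψ => ?_).trans ?_
  · rw [abs_sub_comm]
    refine (μ.abs_MA_sub_le h hφ ψ.2).trans ?_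
    have h1 : S.potentialEnergy ω ψ ≤ c ^ 2 * (R + ν.relJ ψ) :=
      (ν.potentialEnergy_le h ψ.2).trans (by gcongr)
    gcongr
  · have h1 : √(1 + c ^ 2 * (R + 0) + R) ≤ 2 * c * √R := by
      rw [Real.sqrt_le_left (by positivity), mul_pow, Real.sq_sqrt (by linarith)]
      have : 1 ≤ c ^ 2 := one_le_pow₀ hc1
      nlinarith
    calc _ ≤ c ^ 4 * ((2 * c * √R) * √(S.dirichletQM ω μ ν)) := by gcongr
      _ = _ := by ring

/-- With φ maximizing for μ and ψ for ν, J(μ, ψ) + J(ν, φ) equals J(ν, ψ) + J(μ, φ) plus the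
integral of ψ - φ against μ - ν. The first two terms of the latter sum tend to 0, J(ν, φ) ≥ 0 is
dropped, and the integral is linear in d, with a factor √R from the energies of φ and ψ. -/
lemma dirichletQM_le_dualDist (h : S.IsAdmissible ω) {μ ν : S.FiniteEnergyMeasure ω} {R : ℝ}
    (hR : 1 ≤ R) (hμ : μ.J ≤ R) (hν : ν.J ≤ R) :
    S.dirichletQM ω μ ν ≤ 4 * energyConst n ^ 3 * μ.dualDist ν * √R := by
  have := ν.maximizing_neBot h
  have := μ.maximizing_neBot h
  have hc1 := one_le_energyConst n
  have hc := energyConst_pos n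
  have hd := dualDist_nonneg μ ν
  set c := energyConst n with hc'
  set G : ℝ → ℝ := fun r => r + c ^ 2 * (√(c ^ 2 * (R + r)) + 1) * μ.dualDist ν with hG
  have hGc : Continuous G := by fun_prop
  have lim : Tendsto (fun p : S.psh ω × S.psh ω => G (ν.relJ p.2) + G (μ.relJ p.1))
      (μ.maximizing ×ˢ ν.maximizing) (𝓝 (G 0 + G 0)) :=
    ((hGc.tendsto 0).comp (ν.tendsto_relJ_maximizing.comp tendsto_snd)).add
      ((hGc.tendsto 0).comp (μ.tendsto_relJ_maximizing.comp tendsto_fst))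
  refine (le_of_tendsto_of_tendsto' ((μ.tendsto_dirichletQM h ν).comp tendsto_snd) lim
    fun ⟨φ, ψ⟩ => ?_).trans ?_
  · have e : μ.relJ ψ + ν.relJ φ = ν.relJ ψ + μ.relJ φ
        + (μ.toRadon ((ψ : S.D) : C(X, ℝ)) - ν.toRadon ((ψ : S.D) : C(X, ℝ)))
        - (μ.toRadon ((φ : S.D) : C(X, ℝ)) - ν.toRadon ((φ : S.D) : C(X, ℝ))) := by
      simp only [relJ]; ring
    have e1 := ν.relJ_nonneg h φ.2
    have e2 := (abs_le.1 (abs_sub_le_dualDist h μ ν ψ.2)).2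
    have e3 := (abs_le.1 (abs_sub_le_dualDist h μ ν φ.2)).1
    have e4 : S.potentialEnergy ω ψ ≤ c ^ 2 * (R + ν.relJ ψ) :=
      (ν.potentialEnergy_le h ψ.2).trans (by gcongr)
    have e5 : S.potentialEnergy ω φ ≤ c ^ 2 * (R + μ.relJ φ) :=
      (μ.potentialEnergy_le h φ.2).trans (by gcongr)
    have e6 : c ^ 2 * (√(S.potentialEnergy ω ψ) + 1) * μ.dualDist ν
      ≤ c ^ 2 * (√(c ^ 2 * (R + ν.relJ ψ)) + 1) * μ.dualDist ν := by gcongr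
    have e7 : c ^ 2 * (√(S.potentialEnergy ω φ) + 1) * μ.dualDist ν
      ≤ c ^ 2 * (√(c ^ 2 * (R + μ.relJ φ)) + 1) * μ.dualDist ν := by gcongr
    simp only [hG, Function.comp_apply]
    linarith
  · have h1 : √(c ^ 2 * (R + 0)) + 1 ≤ 2 * c * √R := by
      have : 1 ≤ √R := Real.one_le_sqrt.2 hR
      rw [add_zero, Real.sqrt_mul (by positivity), Real.sqrt_sq hc.le]
      nlinarith
    calc G 0 + G 0 = 2 * (c ^ 2 * (√(c ^ 2 * (R + 0)) + 1) * μ.dualDist ν) := by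
          simp only [hG]; ring
      _ ≤ 2 * (c ^ 2 * (2 * c * √R) * μ.dualDist ν) := by gcongr
      _ = _ := by ring

lemma isQuasiMetric_dirichletQM (h : S.IsAdmissible ω) : IsQuasiMetric (S.dirichletQM ω) where
  nonneg := dirichletQM_nonneg h
  quasi_symm := by
    have hc : 0 < energyConst n ^ 2 := pow_pos (energyConst_pos n) 2
    refine ⟨_, hc, fun μ ν => ⟨?_, dirichletQM_comm_le h μ ν⟩⟩
    rw [inv_mul_le_iff₀ hc]
    exact dirichletQM_comm_le h ν μ
  quasi_triangle := ⟨_, pow_pos (energyConst_pos n) 4, dirichletQM_triangle h⟩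
  separates := fun μ ν => by
    constructor
    · intro h0
      refine eq_of_dualDist_eq_zero h (le_antisymm ?_ (dualDist_nonneg _ _))
      have h1 := dualDist_le_sqrt_dirichletQM h (μ := μ) (ν := ν) (R := 1 + μ.J + ν.J)
        (by linarith [μ.J_nonneg h, ν.J_nonneg h]) (by linarith [ν.J_nonneg h])
        (by linarith [μ.J_nonneg h])
      simpa [h0] using h1
    · rintro rfl
      have := μ.maximizing_neBot h
      exact tendsto_nhds_unique (μ.tendsto_dirichletQM h μ) μ.tendsto_relJ_maximizing

/-- The energy is bounded on sets that are bounded for the dual distance. -/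
lemma J_le_of_dualDist (h : S.IsAdmissible ω) (μ : S.FiniteEnergyMeasure ω) :
    μ.J ≤ 1 + (4 * energyConst n ^ 3
      * μ.dualDist (h.toMeasure ⟨0, zero_mem_psh h.nonneg⟩)) ^ 2 := by
  set ν := h.toMeasure ⟨0, zero_mem_psh h.nonneg⟩ with hν
  have hνJ : ν.J = 0 := by rw [hν, h.J_toMeasure, dirichlet_self]
  have h1 : S.dirichletQM ω μ ν = μ.J := by rw [hν, dirichletQM_toMeasure_right, relJ_zero]
  by_cases hJ : μ.J ≤ 1
  · exact hJ.trans (le_add_of_nonneg_right (sq_nonneg _))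
  · push Not at hJ
    -- With R = J(μ), this reads J(μ) ≤ 4 c³ d(μ, ν) √J(μ); one factor √J(μ) is divided out.
    have h2 := dirichletQM_le_dualDist h hJ.le le_rfl (show ν.J ≤ μ.J by linarith)
    have h3 : 0 < √μ.J := Real.sqrt_pos.2 (by linarith)
    rw [h1] at h2
    nth_rewrite 1 [← Real.mul_self_sqrt (show 0 ≤ μ.J by linarith)] at h2
    have h4 := le_of_mul_le_mul_right h2 h3
    have h5 := pow_le_pow_left₀ h3.le h4 2
    rw [Real.sq_sqrt (by linarith)] at h5
    linarith

/-- Maximizing potentials of μ serve as competitors in the supremum defining J(ν). -/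
lemma J_sub_le (h : S.IsAdmissible ω) (μ ν : S.FiniteEnergyMeasure ω) :
    μ.J - ν.J ≤ energyConst n ^ 2 * (√(energyConst n ^ 2 * μ.J) + 1) * μ.dualDist ν := by
  have := μ.maximizing_neBot h
  have hd := dualDist_nonneg μ ν
  set c := energyConst n with hc'
  set G : ℝ → ℝ := fun r => r + c ^ 2 * (√(c ^ 2 * (μ.J + r)) + 1) * μ.dualDist ν with hG
  have hGc : Continuous G := by fun_prop
  have lim := (hGc.tendsto 0).comp μ.tendsto_relJ_maximizing
  have h0 : G 0 = c ^ 2 * (√(c ^ 2 * μ.J) + 1) * μ.dualDist ν := by simp [hG]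
  rw [← h0]
  refine ge_of_tendsto' lim fun ψ => ?_
  have e1 := ν.energy_sub_le_J h ψ.2
  have e2 := (abs_le.1 (abs_sub_le_dualDist h μ ν ψ.2)).1
  have e3 := μ.potentialEnergy_le h ψ.2
  have e4 : c ^ 2 * (√(S.potentialEnergy ω ψ) + 1) * μ.dualDist ν
      ≤ c ^ 2 * (√(c ^ 2 * (μ.J + μ.relJ ψ)) + 1) * μ.dualDist ν := by gcongr
  have e5 : μ.relJ ψ = μ.J - S.mongeAmpereEnergy ω ψ + μ.toRadon ((ψ : S.D) : C(X, ℝ)) := rfl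
  simp only [hG, Function.comp_apply]
  linarith

end FiniteEnergyMeasure

end PluriData

/-! ### The dual metric: strong topology, uniqueness of δ, completeness, bounded sets. -/

namespace PluriData

variable {X : Type*} [TopologicalSpace X] [CompactSpace X]
  {Z : Type*} [AddCommGroup Z] [Module ℝ Z] [PartialOrder Z] {n : ℕ}
  {S : PluriData X Z n} {ω : Z} [IsOrderedAddMonoid Z] [IsOrderedModule ℝ Z] [NeZero n]

namespace FiniteEnergyMeasure

/-- The dual metric on measures of finite energy. -/
@[reducible] def dualMetric (h : S.IsAdmissible ω) : MetricSpace (S.FiniteEnergyMeasure ω) where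
  dist := dualDist
  dist_self := dualDist_self
  dist_comm := dualDist_comm
  dist_triangle := dualDist_triangle h
  edist := S.dualDist ω
  edist_dist μ ν := (ofReal_dualDist h μ ν).symm
  eq_of_dist_eq_zero := eq_of_dualDist_eq_zero h

lemma continuous_of_dualDist_bound (h : S.IsAdmissible ω) (F : S.FiniteEnergyMeasure ω → ℝ)
    (H : ∀ μ, ∃ L : ℝ, 0 ≤ L ∧ ∀ ν, ν.dualDist μ < 1 → |F ν - F μ| ≤ L * ν.dualDist μ) :
    @Continuous _ _ (dualMetric h).toPseudoMetricSpace.toUniformSpace.toTopologicalSpace _ F := by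
  let := dualMetric h
  refine Metric.continuous_iff.2 fun μ ε hε => ?_
  obtain ⟨L, hL, hLμ⟩ := H μ
  refine ⟨min 1 (ε / (L + 1)), by positivity, fun ν hν => ?_⟩
  have hν' : ν.dualDist μ < min 1 (ε / (L + 1)) := hν
  have h1 := hν'.trans_le (min_le_right _ _)
  rw [lt_div_iff₀ (by positivity)] at h1
  rw [Real.dist_eq]
  have h2 := hLμ ν (hν'.trans_le (min_le_left _ _))
  nlinarith [dualDist_nonneg ν μ]

lemma continuous_J_dualMetric (h : S.IsAdmissible ω) :
    @Continuous _ _ (dualMetric h).toPseudoMetricSpace.toUniformSpace.toTopologicalSpace _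
      (fun μ : S.FiniteEnergyMeasure ω => μ.J) := by
  refine continuous_of_dualDist_bound h _ fun μ => ?_
  have hc := energyConst_pos n
  set c := energyConst n with hc'
  set ν₀ := h.toMeasure ⟨0, zero_mem_psh h.nonneg⟩ with hν₀
  have hd0 := dualDist_nonneg μ ν₀
  set B := 1 + (4 * c ^ 3 * (1 + μ.dualDist ν₀)) ^ 2 with hB
  have hJB : ∀ ν : S.FiniteEnergyMeasure ω, ν.dualDist μ < 1 → ν.J ≤ B := by
    intro ν hν
    refine (ν.J_le_of_dualDist h).trans ?_
    have h1 := dualDist_triangle h ν μ ν₀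
    have h2 := dualDist_nonneg ν ν₀
    rw [hB]
    gcongr
    linarith
  refine ⟨c ^ 2 * (√(c ^ 2 * B) + 1), by positivity, fun ν hν => ?_⟩
  have h1 := ν.J_sub_le h μ
  have h2 := μ.J_sub_le h ν
  rw [dualDist_comm μ ν] at h2
  have hd := dualDist_nonneg ν μ
  have h3 := hJB ν hν
  have h4 := hJB μ (by rw [dualDist_self]; exact one_pos)
  have h5 : c ^ 2 * (√(c ^ 2 * ν.J) + 1) * ν.dualDist μ
    ≤ c ^ 2 * (√(c ^ 2 * B) + 1) * ν.dualDist μ := by gcongr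
  have h6 : c ^ 2 * (√(c ^ 2 * μ.J) + 1) * ν.dualDist μ
    ≤ c ^ 2 * (√(c ^ 2 * B) + 1) * ν.dualDist μ := by gcongr
  rw [abs_le]
  constructor <;> linarith

lemma continuous_toRadon_dualMetric (h : S.IsAdmissible ω) :
    @Continuous _ _ (dualMetric h).toPseudoMetricSpace.toUniformSpace.toTopologicalSpace _
      (fun μ : S.FiniteEnergyMeasure ω => μ.toRadon) := by
  let := dualMetric h
  refine @WeakDual.continuous_of_continuous_eval _ _ _ _ _ _ _ _ _ _
    (dualMetric h).toPseudoMetricSpace.toUniformSpace.toTopologicalSpace _ fun f => ?_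
  have hD : ∀ g : S.D, @Continuous _ _
      (dualMetric h).toPseudoMetricSpace.toUniformSpace.toTopologicalSpace _
      (fun μ : S.FiniteEnergyMeasure ω => μ.toRadon (g : C(X, ℝ))) := fun g => by
    obtain ⟨L, hL, hL'⟩ := exists_abs_sub_le_dualDist h g
    exact continuous_of_dualDist_bound h _ fun μ => ⟨L, hL, fun ν _ => hL' ν μ⟩
  show @Continuous _ _ (dualMetric h).toPseudoMetricSpace.toUniformSpace.toTopologicalSpace _
    (fun μ : S.FiniteEnergyMeasure ω => μ.toRadon f)
  refine Metric.continuous_iff.2 fun μ ε hε => ?_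
  obtain ⟨g, hg, hfg⟩ := Metric.mem_closure_iff.1 (S.dense_D f) (ε / 3) (by positivity)
  obtain ⟨ρ, hρ, hρ'⟩ := Metric.continuous_iff.1 (hD ⟨g, hg⟩) μ (ε / 3) (by positivity)
  refine ⟨ρ, hρ, fun ν hν => ?_⟩
  have h1 := hρ' ν hν
  have h2 := ν.isProbability.abs_le (f - g)
  have h3 := μ.isProbability.abs_le (f - g)
  rw [dist_eq_norm] at hfg
  rw [map_sub] at h2 h3
  rw [Real.dist_eq] at h1 ⊢
  have h2' := abs_le.1 h2
  have h3' := abs_le.1 h3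
  have h1' := abs_lt.1 h1
  simp only at h1'
  rw [abs_lt]
  constructor <;> linarith [h1'.1, h1'.2, h2'.1, h2'.2, h3'.1, h3'.2]

/-- The dual distance between two measures admitting a common almost maximizing potential. -/
lemma dualDist_le_of_relJ (h : S.IsAdmissible ω) {μ ν : S.FiniteEnergyMeasure ω} {ψ : S.D}
    (hψ : ψ ∈ S.psh ω) {R η : ℝ} (hμR : μ.J ≤ R) (hνR : ν.J ≤ R) (hη1 : η ≤ 1)
    (hμ : μ.relJ ψ ≤ η) (hν : ν.relJ ψ ≤ η) :
    μ.dualDist ν ≤ 2 * (energyConst n ^ 4 * (√(1 + energyConst n ^ 2 * (R + 1) + R) * √η)) := by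
  have hc := energyConst_pos n
  have key : ∀ ρ : S.FiniteEnergyMeasure ω, ρ.J ≤ R → ρ.relJ ψ ≤ η → ∀ φ ∈ S.psh ω,
      S.potentialEnergy ω φ ≤ 1 → |ρ.toRadon (φ : C(X, ℝ)) - S.MA ω ψ (φ : C(X, ℝ))|
        ≤ energyConst n ^ 4 * (√(1 + energyConst n ^ 2 * (R + 1) + R) * √η) := by
    intro ρ hρ hρη φ hφ hφ1
    have := hρη.trans hη1
    refine (ρ.abs_sub_MA_le h hφ hφ1 hψ).trans ?_
    gcongr
  refine dualDist_le (by positivity) fun φ hφ hφ1 => ?_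
  have h1 := key μ hμR hμ φ hφ hφ1
  have h2 := key ν hνR hν φ hφ hφ1
  rw [abs_sub_comm] at h2
  refine (abs_sub_le _ (S.MA ω ψ (φ : C(X, ℝ))) _).trans ?_
  linarith

/-- The metric topology is finer because energy and integrals are continuous for d. Conversely, for
ψ almost maximizing at μ, the conditions J(ν) < J(μ) + 1 and J(ν, ψ) < η on ν are strongly open, and
they force MA(ψ) to be close to both measures. -/
lemma dualMetric_topology_eq (h : S.IsAdmissible ω) :
    (dualMetric h).toPseudoMetricSpace.toUniformSpace.toTopologicalSpace
      = S.strongTopology ω := by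
  apply le_antisymm
  · exact le_inf (continuous_iff_le_induced.1 (continuous_toRadon_dualMetric h))
      (continuous_iff_le_induced.1 (continuous_J_dualMetric h))
  · refine le_of_nhds_le_nhds fun μ => ?_
    intro s hs
    obtain ⟨ε, hε, hs⟩ := (@Metric.mem_nhds_iff _ (dualMetric h).toPseudoMetricSpace _ _).1 hs
    have hcont : Continuous fun η : ℝ => 2 * (energyConst n ^ 4
      * (√(1 + energyConst n ^ 2 * ((μ.J + 1) + 1) + (μ.J + 1)) * √η)) := by fun_prop
    have hlim := hcont.tendsto 0
    simp only [Real.sqrt_zero, mul_zero] at hlim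
    obtain ⟨η, ⟨hηε, hη1⟩, hη0⟩ := (((hlim.eventually_lt_const hε).and
      (eventually_le_nhds (zero_lt_one (α := ℝ)))).filter_mono (nhdsWithin_le_nhds (s := Set.Ioi 0))
      |>.and self_mem_nhdsWithin).exists
    obtain ⟨ψ, hψ, hψη⟩ := μ.exists_relJ_lt h hη0
    have e1 := (continuous_J.tendsto μ).eventually_lt_const (show μ.J < μ.J + 1 by linarith)
    have e2 := ((continuous_relJ ψ).tendsto μ).eventually_lt_const hψη
    filter_upwards [e1, e2] with ν hν1 hν2
    exact hs ((dualDist_le_of_relJ h hψ hν1.le (by linarith) hη1 hν2.le hψη.le).trans_lt hηε)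

/-- Monge–Ampère measures are therefore strongly dense, which makes the continuous extension of J
unique. -/
lemma tendsto_toMeasure (h : S.IsAdmissible ω) (μ : S.FiniteEnergyMeasure ω) :
    Tendsto h.toMeasure μ.maximizing (𝓝 μ) := by
  have hμ0 := μ.J_nonneg h
  have hc := energyConst_pos n
  have key : Tendsto h.toMeasure μ.maximizing
      (@nhds _ (dualMetric h).toPseudoMetricSpace.toUniformSpace.toTopologicalSpace μ) := by
    let := dualMetric h
    rw [tendsto_iff_dist_tendsto_zero]
    have hcont : Continuous fun η : ℝ => energyConst n ^ 4 *
      (√(1 + energyConst n ^ 2 * (μ.J + η) + μ.J) * √η) := by fun_prop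
    have hlim := (hcont.tendsto 0).comp μ.tendsto_relJ_maximizing
    simp only [Real.sqrt_zero, mul_zero] at hlim
    refine squeeze_zero (fun _ => dist_nonneg) (fun ψ => ?_) hlim
    have hr := μ.relJ_nonneg h ψ.2
    refine dualDist_le (mul_nonneg (by positivity) (by positivity)) fun φ hφ hφ1 => ?_
    rw [abs_sub_comm]
    exact μ.abs_sub_MA_le h hφ hφ1 ψ.2
  rwa [dualMetric_topology_eq] at key

lemma eq_dirichletQM (h : S.IsAdmissible ω)
    (δ : S.FiniteEnergyMeasure ω → S.FiniteEnergyMeasure ω → ℝ) (hδ : S.ExtendsDirichlet ω δ) :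
    δ = S.dirichletQM ω := by
  ext μ ν
  have := μ.maximizing_neBot h
  have := ν.maximizing_neBot h
  have h1 : Tendsto (fun p : S.psh ω × S.psh ω => (h.toMeasure p.1, h.toMeasure p.2))
      (μ.maximizing ×ˢ ν.maximizing) (𝓝 (μ, ν)) :=
    ((μ.tendsto_toMeasure h).comp tendsto_fst).prodMk_nhds
      ((ν.tendsto_toMeasure h).comp tendsto_snd)
  have h2 := (hδ.1.tendsto (μ, ν)).comp h1
  refine tendsto_nhds_unique h2 ((μ.tendsto_dirichlet_prod h ν).congr fun p => ?_)
  obtain ⟨μ', ν', hμ', hν', e⟩ := hδ.2 p.1 p.1.2 p.2 p.2.2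
  have e1 : μ' = h.toMeasure p.1 := FiniteEnergyMeasure.ext hμ'
  have e2 : ν' = h.toMeasure p.2 := FiniteEnergyMeasure.ext hν'
  subst e1 e2
  exact e.symm

/-- A sequence of measures of uniformly bounded energy has a weak limit point of finite energy. -/
lemma exists_ultrafilter_limit (h : S.IsAdmissible ω) (u : ℕ → S.FiniteEnergyMeasure ω) {B : ℝ}
    (hB : ∀ i, (u i).J ≤ B) : ∃ (a : S.FiniteEnergyMeasure ω) (U : Ultrafilter ℕ),
      (U : Filter ℕ) ≤ atTop ∧
      ∀ f : C(X, ℝ), Tendsto (fun i => (u i).toRadon f) U (𝓝 (a.toRadon f)) := by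
  have hK := WeakDual.isCompact_closedBall (0 : StrongDual ℝ C(X, ℝ)) 1
  set U : Ultrafilter ℕ := hyperfilter ℕ
  have hU : (U : Filter ℕ) ≤ atTop := by
    rw [← Nat.cofinite_eq_atTop]; exact hyperfilter_le_cofinite
  have hmem : ∀ i, (u i).toRadon ∈
      WeakDual.toStrongDual ⁻¹' Metric.closedBall (0 : StrongDual ℝ C(X, ℝ)) 1 := by
    intro i
    refine (mem_closedBall_zero_iff (a := WeakDual.toStrongDual (u i).toRadon)).2 ?_
    refine ContinuousLinearMap.opNorm_le_bound _ zero_le_one fun f => ?_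
    rw [one_mul]
    exact (u i).isProbability.abs_le f
  obtain ⟨a, -, ha⟩ := isCompact_iff_ultrafilter_le_nhds.1 hK (U.map fun i => (u i).toRadon)
    (by
      rw [le_principal_iff]
      exact Filter.mem_map.2 (Eventually.of_forall hmem))
  have lim : ∀ f : C(X, ℝ), Tendsto (fun i => (u i).toRadon f) U (𝓝 (a f)) := fun f =>
    ((WeakDual.eval_continuous f).tendsto a).comp ha
  have hprob : SignedRadon.IsProbability a :=
    ⟨fun f hf => ge_of_tendsto' (lim f) fun i => (u i).isProbability.1 f hf,
      tendsto_nhds_unique (lim 1) (by simp [(u _).isProbability.2])⟩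
  -- The energy is a supremum of weakly continuous functions of the measure, so its upper bounds
  -- survive weak limits.
  have hen : S.energy ω a ≤ (B : EReal) := by
    refine iSup_le fun φ => EReal.coe_le_coe_iff.2 ?_
    have h1 : S.mongeAmpereEnergy ω φ - a ((φ : S.D) : C(X, ℝ)) ≤ B :=
      le_of_tendsto' ((lim _).const_sub _) fun i => ((u i).energy_sub_le_J h φ.2).trans (hB i)
    simp only [mongeAmpereEnergy_zero, Submodule.coe_zero, zero_sub, map_neg, sub_zero]
    linarith
  exact ⟨⟨a, hprob, hen.trans_lt (EReal.coe_lt_top _)⟩, U, hU, lim⟩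

/-- A Cauchy sequence is bounded, hence has bounded energy, hence a weak limit point of finite
energy. The Cauchy bound passes to this limit for each test function separately, so it holds for the
supremum. -/
lemma completeSpace_dualMetric (h : S.IsAdmissible ω) :
    @CompleteSpace _ (dualMetric h).toPseudoMetricSpace.toUniformSpace := by
  let := dualMetric h
  refine Metric.complete_of_cauchySeq_tendsto fun u hu => ?_
  have hc := energyConst_pos n
  set ν₀ := h.toMeasure ⟨0, zero_mem_psh h.nonneg⟩ with hν₀
  obtain ⟨R, hR, hRu⟩ := cauchySeq_bdd hu
  have hB : ∀ i, (u i).J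
      ≤ 1 + (4 * energyConst n ^ 3 * (R + (u 0).dualDist ν₀)) ^ 2 := by
    intro i
    refine ((u i).J_le_of_dualDist h).trans ?_
    have h1 := dualDist_triangle h (u i) (u 0) ν₀
    have h2 : (u i).dualDist (u 0) < R := hRu i 0
    have h3 := dualDist_nonneg (u i) ν₀
    gcongr
    linarith
  obtain ⟨a, U, hU, lim⟩ := exists_ultrafilter_limit h u hB
  refine ⟨a, Metric.tendsto_atTop.2 fun ε hε => ?_⟩
  obtain ⟨N, hN⟩ := Metric.cauchySeq_iff.1 hu (ε / 2) (half_pos hε)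
  refine ⟨N, fun i hi => ?_⟩
  refine lt_of_le_of_lt (dualDist_le (half_pos hε).le fun φ hφ hφ1 => ?_) (half_lt_self hε)
  refine le_of_tendsto ((lim φ).const_sub _).abs (hU ?_)
  filter_upwards [eventually_ge_atTop N] with j hj
  exact (abs_sub_le_dualDist_of_le_one h _ _ hφ hφ1).trans (hN i hi j hj).le

/-- Boundedness for either function bounds the energy J(μ) = δ(μ, MA(0)) on the set; the Hölder
estimates then transfer the bound. -/
lemma bounded_dualDist_iff (h : S.IsAdmissible ω) (A : Set (S.FiniteEnergyMeasure ω)) :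
    (∃ K : ℝ, ∀ μ ∈ A, ∀ ν ∈ A, μ.dualDist ν ≤ K) ↔
      ∃ K : ℝ, ∀ μ ∈ A, ∀ ν ∈ A, S.dirichletQM ω μ ν ≤ K := by
  have hc := energyConst_pos n
  set ν₀ := h.toMeasure ⟨0, zero_mem_psh h.nonneg⟩ with hν₀
  rcases A.eq_empty_or_nonempty with rfl | ⟨μ₁, hμ₁⟩
  · simp
  constructor
  · rintro ⟨K, hK⟩
    set R := 1 + (4 * energyConst n ^ 3 * (K + μ₁.dualDist ν₀)) ^ 2 with hR
    have hJ : ∀ μ ∈ A, μ.J ≤ R := by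
      intro μ hμ
      refine (μ.J_le_of_dualDist h).trans ?_
      have h1 := dualDist_triangle h μ μ₁ ν₀
      have h2 := hK μ hμ μ₁ hμ₁
      have h3 := dualDist_nonneg μ ν₀
      rw [hR]
      gcongr
      linarith
    refine ⟨4 * energyConst n ^ 3 * K * √R, fun μ hμ ν hν => ?_⟩
    refine (dirichletQM_le_dualDist h (le_add_of_nonneg_right (sq_nonneg _)) (hJ μ hμ)
      (hJ ν hν)).trans ?_
    have := hK μ hμ ν hν
    gcongr
  · rintro ⟨K, hK⟩
    set R := 1 + energyConst n ^ 4 * |K + S.dirichletQM ω μ₁ ν₀| with hR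
    have hJ : ∀ μ ∈ A, μ.J ≤ R := by
      intro μ hμ
      have h1 := dirichletQM_triangle h μ ν₀ μ₁
      rw [hν₀, dirichletQM_toMeasure_right, relJ_zero, ← hν₀] at h1
      have h2 := hK μ hμ μ₁ hμ₁
      have h3 : energyConst n ^ 4 * (S.dirichletQM ω μ μ₁ + S.dirichletQM ω μ₁ ν₀)
          ≤ energyConst n ^ 4 * |K + S.dirichletQM ω μ₁ ν₀| := by
        gcongr
        exact le_trans (by linarith) (le_abs_self _)
      linarith
    refine ⟨2 * energyConst n ^ 5 * √K * √R, fun μ hμ ν hν => ?_⟩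
    refine (dualDist_le_sqrt_dirichletQM h (le_add_of_nonneg_right (by positivity)) (hJ μ hμ)
      (hJ ν hν)).trans ?_
    have := hK μ hμ ν hν
    gcongr

end FiniteEnergyMeasure

end PluriData

end

theorem mainTheorem11 (n : ℕ) (hn : 1 ≤ n) :
    ∃ C : ℝ, 0 < C ∧
      ∀ (X : Type*) [TopologicalSpace X] [CompactSpace X] [T2Space X]
        (Z : Type*) [AddCommGroup Z] [Module ℝ Z] [PartialOrder Z] [IsOrderedAddMonoid Z]
        [IsOrderedModule ℝ Z] (S : PluriData X Z n) (ω : Z),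
        0 ≤ ω → (LinearMap.range S.ddc).mkQ ω ∈ S.posCone → S.Orthogonality ω →
        -- the Dirichlet quasi-metric is well defined
        (IsQuasiMetric (S.dirichletQM ω) ∧ S.ExtendsDirichlet ω (S.dirichletQM ω) ∧
          ∀ δ, S.ExtendsDirichlet ω δ → δ = S.dirichletQM ω) ∧
        ∃ m : MetricSpace (S.FiniteEnergyMeasure ω),
          -- the supremum is finite, and is a complete metric defining the strong topology
          (∀ μ ν : S.FiniteEnergyMeasure ω, m.toPseudoMetricSpace.edist μ ν = S.dualDist ω μ ν) ∧
          m.toPseudoMetricSpace.toUniformSpace.toTopologicalSpace = S.strongTopology ω ∧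
          @CompleteSpace _ m.toPseudoMetricSpace.toUniformSpace ∧
          -- (i) same bounded sets
          (∀ A : Set (S.FiniteEnergyMeasure ω),
            (∃ K : ℝ, ∀ μ ∈ A, ∀ ν ∈ A, m.dist μ ν ≤ K) ↔
              ∃ K : ℝ, ∀ μ ∈ A, ∀ ν ∈ A, S.dirichletQM ω μ ν ≤ K) ∧
          -- (ii) Hölder equivalence on bounded sets
          (∀ R : ℝ, 1 ≤ R → ∀ μ ν : S.FiniteEnergyMeasure ω, μ.J ≤ R → ν.J ≤ R →
            m.dist μ ν ≤ C * √(S.dirichletQM ω μ ν) * √R ∧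
              S.dirichletQM ω μ ν ≤ C * m.dist μ ν * √R) ∧
          -- (iii) integrals of psh test functions
          (∀ φ ∈ S.psh ω, ∀ μ ν : S.FiniteEnergyMeasure ω,
            |μ.toRadon (φ : C(X, ℝ)) - ν.toRadon (φ : C(X, ℝ))| ≤
              C * (√(S.potentialEnergy ω φ) + 1) * m.dist μ ν) := by
  have : NeZero n := ⟨by omega⟩
  have hc := PluriData.energyConst_pos n
  have hc1 := PluriData.one_le_energyConst n
  have hpow : ∀ k ≤ 5, PluriData.energyConst n ^ k ≤ PluriData.energyConst n ^ 5 := fun k hk => pow_le_pow_right₀ hc1 hk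
  -- With c = `energyConst n` ≥ 1, this dominates the three constants obtained: 2c⁵ and 4c³ in (ii),
  -- c² in (iii).
  refine ⟨4 * PluriData.energyConst n ^ 5, by positivity, ?_⟩
  intro X _ _ _ Z _ _ _ _ _ S ω hω hpos horth
  have h : S.IsAdmissible ω := ⟨hω, hpos, horth⟩
  refine ⟨⟨PluriData.FiniteEnergyMeasure.isQuasiMetric_dirichletQM h,
    PluriData.FiniteEnergyMeasure.extendsDirichlet_dirichletQM h, PluriData.FiniteEnergyMeasure.eq_dirichletQM h⟩,
    PluriData.FiniteEnergyMeasure.dualMetric h, fun _ _ => rfl,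
    PluriData.FiniteEnergyMeasure.dualMetric_topology_eq h, PluriData.FiniteEnergyMeasure.completeSpace_dualMetric h,
    PluriData.FiniteEnergyMeasure.bounded_dualDist_iff h, fun R hR μ ν hμ hν => ⟨?_, ?_⟩,
    fun φ hφ μ ν => ?_⟩
  · refine (PluriData.FiniteEnergyMeasure.dualDist_le_sqrt_dirichletQM h hR hμ hν).trans ?_
    gcongr
    norm_num
  · refine (PluriData.FiniteEnergyMeasure.dirichletQM_le_dualDist h hR hμ hν).trans ?_
    have := PluriData.FiniteEnergyMeasure.dualDist_nonneg μ ν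
    show _ ≤ 4 * PluriData.energyConst n ^ 5 * μ.dualDist ν * √R
    gcongr
    norm_num
  · refine (PluriData.FiniteEnergyMeasure.abs_sub_le_dualDist h μ ν hφ).trans ?_
    have := PluriData.FiniteEnergyMeasure.dualDist_nonneg μ ν
    have := hpow 2 (by norm_num)
    show _ ≤ 4 * PluriData.energyConst n ^ 5 * (√(S.potentialEnergy ω φ) + 1) * μ.dualDist ν
    gcongr
    linarith [pow_pos hc 5]
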